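/- Let $\mathcal P=\langle\Sigma\mid\mathcal R\rangle$ be a semigroup presentation, where $\mathcal R$ is a set of pairs of non-empty words over $\Sigma$ such that $(u,v)\in\mathcal R$ implies $(v,u)\notin\mathcal R$, and let $w$ be a non-empty word over $\Sigma$. Semigroup diagrams over $\mathcal P$ are considered up to isotopy. Write $\epsilon(w)$ for the trivial diagram, $\Delta_1\circ\Delta_2$ for concatenation, $\Delta_1+\Delta_2$ for the sum, and $\Delta_1\cdot\Delta_2$ for the reduced form of $\Delta_1\circ\Delta_2$ (all dipoles removed). Write $\Delta\le D$ if $\Delta$ is a prefix of $D$, i.e. $D=\Delta\circ\Gamma$ for some diagram $\Gamma$; suffixes are defined similarly. A diagram is atomic if it has exactly one cell, and thin if it is trivial or a sum of atomic diagrams. The Farley complex $X=X(\mathcal P,w)$ is the cube complex whose vertices are the reduced diagrams with top path labelled by $w$ and whose $n$-cubes are spanned by the sets $\{\Delta\cdot P\mid P\le\Gamma\}$, where $\Delta$ is a vertex and $\Gamma$ is a thin diagram with $n$ cells such that $\Delta\circ\Gamma$ is defined; in particular, two vertices are joined by an edge if and only if one of them is the product $\cdot$ of the other with an atomic diagram.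 A hyperplane $J$ of $X$ is a class of the equivalence relation on the edges generated by being parallel sides of a square; its halfspaces are the connected components of the union of the cubes not crossed by $J$, and halfspaces are identified with their sets of vertices. A reduced diagram $\Delta$ with top path labelled by $w$ is minimal if its maximal thin suffix $F$ (the thin suffix of which every thin suffix of $\Delta$ is a suffix) has exactly one cell; then put $\overline\Delta=\Delta\cdot F^{-1}$. 1. For every hyperplane $J$ of $X$ there is a unique minimal diagram $\Delta$ such that $J$ has exactly one halfspace $J^+$ not containing $\epsilon(w)$ and $J^+=\{D\text{ vertex of }X\mid\Delta\le D\}$. 2. Conversely, if $\Delta$ is a minimal diagram, then $\Delta$ and $\overline\Delta$ are joined by an edge of $X$, and the hyperplane $J$ dual to (i.e. containing) the edge $[\Delta,\overline\Delta]$ has exactly one halfspace $J^+$ not containing $\epsilon(w)$, namely $J^+=\{D\text{ vertex of }X\mid\Delta\le D\}$. 3. Consequently, $J\mapsto\Delta$ is a bijection from the set of hyperplanes of $X$ onto the set of minimal diagrams. -/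

import Mathlib

/-- A semigroup presentation `⟨α ∣ R⟩`. Words are lists of letters; the two sides of a relation are
non-empty words, and if `u = v` is a relation then `v = u` is not one. -/
structure SemigroupPresentation (α : Type*) where
  rels : Set (List α × List α)
  ne_nil : ∀ {u v : List α}, (u, v) ∈ rels → u ≠ [] ∧ v ≠ []
  asymm : ∀ {u v : List α}, (u, v) ∈ rels → (v, u) ∉ rels

namespace SemigroupPresentation

variable {α : Type*}

/-- There is a `(u, v)`-cell over `P`: `u = v` or `v = u` is a relation. -/
def IsCell (P : SemigroupPresentation α) (u v : List α) : Prop :=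
  (u, v) ∈ P.rels ∨ (v, u) ∈ P.rels

theorem IsCell.symm {P : SemigroupPresentation α} {u v : List α} (h : P.IsCell u v) :
    P.IsCell v u := Or.symm h

/-- An elementary step `(left, src → tgt, right)` of a derivation, which replaces the subword `src`
of the word `left src right` by `tgt`. -/
@[ext]
structure Step (α : Type*) where
  left : List α
  src : List α
  tgt : List α
  right : List α

namespace Step

def top (s : Step α) : List α := s.left ++ s.src ++ s.right

def bot (s : Step α) : List α := s.left ++ s.tgt ++ s.right

/-- The step `(left, tgt → src, right)`. -/
def inv (s : Step α) : Step α := ⟨s.left, s.tgt, s.src, s.right⟩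

/-- The step `(x left, src → tgt, right y)`. -/
def whisker (x y : List α) (s : Step α) : Step α := ⟨x ++ s.left, s.src, s.tgt, s.right ++ y⟩

end Step

/-- `P.IsDerivation u l v`: the list of steps `l` is a derivation over `P` from `u` to `v`. -/
def IsDerivation (P : SemigroupPresentation α) : List α → List (Step α) → List α → Prop
  | u, [], v => u = v
  | u, s :: l, v => P.IsCell s.src s.tgt ∧ s.top = u ∧ IsDerivation P s.bot l v

theorem IsDerivation.append {P : SemigroupPresentation α} {l l' : List (Step α)} :
    ∀ {u v w : List α}, P.IsDerivation u l v → P.IsDerivation v l' w →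
      P.IsDerivation u (l ++ l') w := by
  induction l with
  | nil => intro u v w h h'; cases h; exact h'
  | cons s l ih => intro u v w h h'; exact ⟨h.1, h.2.1, ih h.2.2 h'⟩

theorem IsDerivation.inv {P : SemigroupPresentation α} {l : List (Step α)} :
    ∀ {u v : List α}, P.IsDerivation u l v → P.IsDerivation v (l.map Step.inv).reverse u := by
  induction l with
  | nil => intro u v h; exact Eq.symm h
  | cons s l ih =>
    intro u v h
    rw [List.map_cons, List.reverse_cons]
    exact (ih h.2.2).append ⟨h.1.symm, rfl, h.2.1⟩

theorem IsDerivation.whisker {P : SemigroupPresentation α} (x y : List α) {l : List (Step α)} :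
    ∀ {u v : List α}, P.IsDerivation u l v →
      P.IsDerivation (x ++ u ++ y) (l.map (Step.whisker x y)) (x ++ v ++ y) := by
  induction l with
  | nil => intro u v h; cases h; rfl
  | cons s l ih =>
    intro u v h
    refine ⟨h.1, ?_, ?_⟩
    · rw [← h.2.1]; simp [Step.whisker, Step.top]
    · have := ih h.2.2
      simpa [Step.whisker, Step.bot] using this

/-- Two consecutive steps that rewrite disjoint subwords `u`, `u'` of the word `a u b u' c` are
performed in the other order. -/
inductive Exchange : List (Step α) → List (Step α) → Prop
  | mk (l₁ l₂ : List (Step α)) (a u v b u' v' c : List α) :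
      Exchange
        (l₁ ++ ⟨a, u, v, b ++ u' ++ c⟩ :: ⟨a ++ v ++ b, u', v', c⟩ :: l₂)
        (l₁ ++ ⟨a ++ u ++ b, u', v', c⟩ :: ⟨a, u, v, b ++ v' ++ c⟩ :: l₂)

theorem Exchange.append_left (l : List (Step α)) {l₁ l₂ : List (Step α)} (h : Exchange l₁ l₂) :
    Exchange (l ++ l₁) (l ++ l₂) := by
  obtain ⟨m, n, a, u, v, b, u', v', c⟩ := h
  simpa only [List.append_assoc] using Exchange.mk (l ++ m) n a u v b u' v' c

theorem Exchange.append_right (l : List (Step α)) {l₁ l₂ : List (Step α)} (h : Exchange l₁ l₂) :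
    Exchange (l₁ ++ l) (l₂ ++ l) := by
  obtain ⟨m, n, a, u, v, b, u', v', c⟩ := h
  simpa only [List.append_assoc, List.cons_append] using Exchange.mk m (n ++ l) a u v b u' v' c

theorem Exchange.whisker (x y : List α) {l₁ l₂ : List (Step α)} (h : Exchange l₁ l₂) :
    Exchange (l₁.map (Step.whisker x y)) (l₂.map (Step.whisker x y)) := by
  obtain ⟨m, n, a, u, v, b, u', v', c⟩ := h
  simpa [Step.whisker] using Exchange.mk (m.map (Step.whisker x y)) (n.map (Step.whisker x y))
    (x ++ a) u v b u' v' (c ++ y)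

theorem Exchange.inv {l₁ l₂ : List (Step α)} (h : Exchange l₁ l₂) :
    Exchange (l₂.map Step.inv).reverse (l₁.map Step.inv).reverse := by
  obtain ⟨m, n, a, u, v, b, u', v', c⟩ := h
  simpa [Step.inv] using Exchange.mk (n.map Step.inv).reverse (m.map Step.inv).reverse
    a v u b v' u' c

theorem Exchange.length_eq {l₁ l₂ : List (Step α)} (h : Exchange l₁ l₂) :
    l₁.length = l₂.length := by
  obtain ⟨m, n, a, u, v, b, u', v', c⟩ := h
  simp

/-- The `(u, v)`-diagrams over `P`, up to isotopy. A derivation from `u` to `v` describes the plane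
diagram obtained from the path labelled by `u` by gluing the cells of its steps, one after the
other, below the current bottom path. Every diagram arises in this way, and two derivations describe
isotopic diagrams if and only if they differ by exchanges of consecutive steps whose cells have no
edge in common. -/
def Diagram (P : SemigroupPresentation α) (u v : List α) : Type _ :=
  Quot fun d d' : {l : List (Step α) // P.IsDerivation u l v} => Exchange d.1 d'.1

namespace Diagram

variable {P : SemigroupPresentation α}

/-- The trivial diagram `ε(w)`, without cells. -/
def trivial (P : SemigroupPresentation α) (w : List α) : P.Diagram w w := Quot.mk _ ⟨[], rfl⟩

/-- The diagram `ε(p) + π + ε(q)`, where `π` is a single `(a, b)`-cell. -/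
def cell (p q : List α) {a b : List α} (h : P.IsCell a b) :
    P.Diagram (p ++ a ++ q) (p ++ b ++ q) :=
  Quot.mk _ ⟨[⟨p, a, b, q⟩], h, rfl, rfl⟩

/-- The number of cells. -/
def numCells {u v : List α} (Δ : P.Diagram u v) : ℕ :=
  Quot.lift (fun d => d.1.length) (fun _ _ h => h.length_eq) Δ

/-- The concatenation `Δ₁ ∘ Δ₂`: the bottom path of `Δ₁` is identified with the top path of
`Δ₂`. -/
def comp {u v w : List α} (Δ₁ : P.Diagram u v) (Δ₂ : P.Diagram v w) : P.Diagram u w :=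
  Quot.map₂ (fun d d' => ⟨d.1 ++ d'.1, d.2.append d'.2⟩)
    (fun _ _ _ h => h.append_left _) (fun _ _ _ h => h.append_right _) Δ₁ Δ₂

/-- The sum `Δ₁ + Δ₂`: `Δ₂` is placed to the right of `Δ₁`. -/
def sum {u v u' v' : List α} (Δ₁ : P.Diagram u v) (Δ₂ : P.Diagram u' v') :
    P.Diagram (u ++ u') (v ++ v') :=
  Quot.map₂
    (fun d d' => ⟨d.1.map (Step.whisker [] u') ++ d'.1.map (Step.whisker v []), by
      have h := d.2.whisker [] u'
      have h' := d'.2.whisker v []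
      simp only [List.nil_append, List.append_nil] at h h'
      exact h.append h'⟩)
    (fun _ _ _ h => (h.whisker _ _).append_left _)
    (fun _ _ _ h => (h.whisker _ _).append_right _) Δ₁ Δ₂

/-- The mirror image `Δ⁻¹`. -/
def inv {u v : List α} (Δ : P.Diagram u v) : P.Diagram v u :=
  Quot.lift (fun d => Quot.mk _ ⟨(d.1.map Step.inv).reverse, d.2.inv⟩)
    (fun _ _ h => (Quot.sound h.inv).symm) Δ

theorem numCells_comp {u v w : List α} (Δ₁ : P.Diagram u v) (Δ₂ : P.Diagram v w) :
    (Δ₁.comp Δ₂).numCells = Δ₁.numCells + Δ₂.numCells := by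
  induction Δ₁ using Quot.ind with | mk d =>
  induction Δ₂ using Quot.ind with | mk d' => exact List.length_append

/-- `Δ₁ ≤ Δ₂`: `Δ₁` is a prefix of `Δ₂`. -/
def IsPrefix {u v w : List α} (Δ₁ : P.Diagram u v) (Δ₂ : P.Diagram u w) : Prop :=
  ∃ Δ₃ : P.Diagram v w, Δ₂ = Δ₁.comp Δ₃

/-- `Δ₁` is a suffix of `Δ₂`. -/
def IsSuffix {u v w : List α} (Δ₁ : P.Diagram v w) (Δ₂ : P.Diagram u w) : Prop :=
  ∃ Δ₃ : P.Diagram u v, Δ₂ = Δ₃.comp Δ₁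

/-- An atomic diagram has exactly one cell. -/
def IsAtomic {u v : List α} (Δ : P.Diagram u v) : Prop := Δ.numCells = 1

/-- A diagram is thin if it is a sum of atomic diagrams; trivial diagrams are the thin diagrams
without cells. (A sum of an atomic and a trivial diagram is atomic.) -/
inductive IsThin : ∀ {u v : List α}, P.Diagram u v → Prop
  | trivial (w : List α) : IsThin (trivial P w)
  | sum {u v u' v' : List α} (A : P.Diagram u v) (Γ : P.Diagram u' v') :
      A.IsAtomic → IsThin Γ → IsThin (A.sum Γ)

/-- `F` is the maximal thin suffix of `Δ`: it is a thin suffix of which every thin suffix of `Δ` is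
a suffix. -/
def IsMaximalThinSuffix {u v w : List α} (F : P.Diagram v w) (Δ : P.Diagram u w) : Prop :=
  F.IsThin ∧ F.IsSuffix Δ ∧
    ∀ (v' : List α) (F' : P.Diagram v' w), F'.IsThin → F'.IsSuffix Δ → F'.IsSuffix F

/-- The maximal thin suffix of `Δ` has exactly one cell. -/
def IsMinimal {u w : List α} (Δ : P.Diagram u w) : Prop :=
  ∃ (v : List α) (F : P.Diagram v w), F.IsMaximalThinSuffix Δ ∧ F.numCells = 1

/-- `Δ'` is obtained from `Δ` by reducing a dipole, i.e. an `(a, b)`-cell and a `(b, a)`-cell such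
that the bottom path of the former is the top path of the latter. -/
def ReducesDipole {u v : List α} (Δ Δ' : P.Diagram u v) : Prop :=
  ∃ (p a b q : List α) (h : P.IsCell a b)
    (A : P.Diagram u (p ++ a ++ q)) (B : P.Diagram (p ++ a ++ q) v),
    Δ = A.comp ((cell p q h).comp ((cell p q h.symm).comp B)) ∧ Δ' = A.comp B

/-- A diagram is reduced if it does not contain dipoles. -/
def IsReduced {u v : List α} (Δ : P.Diagram u v) : Prop := ∀ Δ' : P.Diagram u v, ¬ Δ.ReducesDipole Δ'

/-- `R` is the reduced form of `Δ`: it is reduced and obtained from `Δ` by reducing dipoles. -/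
def IsReducedForm {u v : List α} (Δ R : P.Diagram u v) : Prop :=
  R.IsReduced ∧ Relation.ReflTransGen ReducesDipole Δ R

theorem isReduced_trivial (P : SemigroupPresentation α) (w : List α) :
    (trivial P w).IsReduced := by
  rintro Δ' ⟨p, a, b, q, h, A, B, h₁, -⟩
  have h₂ := congrArg numCells h₁
  rw [numCells_comp, numCells_comp] at h₂
  have h₃ : (trivial P w).numCells = 0 := rfl
  have h₄ : (cell p q h).numCells = 1 := rfl
  omega

end Diagram

/-- The vertices of the Farley complex `X(P, w)`: the reduced diagrams with top path labelled by
`w`. -/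
structure FarleyVertex (P : SemigroupPresentation α) (w : List α) where
  bot : List α
  diagram : P.Diagram w bot
  isReduced : diagram.IsReduced

variable {P : SemigroupPresentation α} {w : List α}

namespace FarleyVertex

/-- The vertex `ε(w)`. -/
def base (P : SemigroupPresentation α) (w : List α) : P.FarleyVertex w :=
  ⟨w, Diagram.trivial P w, Diagram.isReduced_trivial P w⟩

/-- `E = D · Γ`, i.e. the vertex `E` is the reduced form of `D ∘ Γ`. -/
def IsProduct (D : P.FarleyVertex w) {x : List α} (Γ : P.Diagram D.bot x)
    (E : P.FarleyVertex w) : Prop :=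
  ∃ (R : P.Diagram w x) (h : (D.diagram.comp Γ).IsReducedForm R), E = ⟨x, R, h.1⟩

/-- The set of the vertices of `X(P, w)` that have `Δ` as a prefix. -/
def prefixCone (Δ : P.FarleyVertex w) : Set (P.FarleyVertex w) :=
  {D | Δ.diagram.IsPrefix D.diagram}

end FarleyVertex

/-- The `1`-skeleton of `X(P, w)`: two vertices are joined by an edge if one is the product of the
other with an atomic diagram. -/
def farleyGraph (P : SemigroupPresentation α) (w : List α) : SimpleGraph (P.FarleyVertex w) :=
  SimpleGraph.fromRel fun D E =>
    ∃ (x : List α) (A : P.Diagram D.bot x), A.IsAtomic ∧ D.IsProduct A E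

/-- `S` is the set of vertices of an `n`-cube of `X(P, w)`, i.e. it is the set of the products
`D · Q`, where `Q` ranges over the prefixes of a thin diagram `Γ` with `n` cells. -/
def IsCube (n : ℕ) (S : Set (P.FarleyVertex w)) : Prop :=
  ∃ (D : P.FarleyVertex w) (y : List α) (Γ : P.Diagram D.bot y), Γ.IsThin ∧ Γ.numCells = n ∧
    S = {E | ∃ (x : List α) (Q : P.Diagram D.bot x), Q.IsPrefix Γ ∧ D.IsProduct Q E}

/-- The edges `e` and `f` are parallel sides of a square of `X(P, w)`: they join vertices of the
square and have no endpoint in common. -/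
def AreParallelSides (e f : (farleyGraph P w).edgeSet) : Prop :=
  ∃ S : Set (P.FarleyVertex w), IsCube 2 S ∧ (∀ D ∈ e.1, D ∈ S) ∧ (∀ D ∈ f.1, D ∈ S) ∧
    ∀ D ∈ e.1, D ∉ f.1

/-- The hyperplanes of `X(P, w)`: the classes of the equivalence relation on the edges that is
generated by being parallel sides of a square. -/
def Hyperplane (P : SemigroupPresentation α) (w : List α) : Type _ :=
  Quot (AreParallelSides (P := P) (w := w))

namespace Hyperplane

/-- The hyperplane dual to an edge. -/
def dual (e : (farleyGraph P w).edgeSet) : Hyperplane P w := Quot.mk _ e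

/-- The set of the edges that belong to the hyperplane. -/
def edges (J : Hyperplane P w) : Set (Sym2 (P.FarleyVertex w)) :=
  {e | ∃ h : e ∈ (farleyGraph P w).edgeSet, dual ⟨e, h⟩ = J}

/-- `S` is the set of vertices of a halfspace of `J`, i.e. of a connected component of the
subcomplex `X \\ J` that consists of the cubes not crossed by `J`. The `1`-skeleton of this
subcomplex is obtained from that of `X(P, w)` by deleting the edges in `J`. -/
def IsHalfspace (J : Hyperplane P w) (S : Set (P.FarleyVertex w)) : Prop :=
  ∃ c : ((farleyGraph P w).deleteEdges J.edges).ConnectedComponent, S = c.supp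

/-- `S` is the halfspace `J⁺`: it is the one and only halfspace of `J` that does not contain
`ε(w)`. -/
def IsPositiveHalfspace (J : Hyperplane P w) (S : Set (P.FarleyVertex w)) : Prop :=
  ∀ T : Set (P.FarleyVertex w), (J.IsHalfspace T ∧ FarleyVertex.base P w ∉ T) ↔ T = S

end Hyperplane

end SemigroupPresentation

/-! An edge of the complex glues or removes one cell, and hyperplanes turn out to be the same thing
as cells. To compare cells of different diagrams, every edge of a diagram carries its whole history
(`PathEdge`): the top path and the bottom label of the cell that produced it, recursively. A cell is
the pair of its top path and its bottom label, and `cells S` reads all cells off the bottom path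
`S`. The model is faithful: for a fixed top label, the bottom path determines the diagram up to
isotopy (`isotopic_of_run_eq`), and so does the bare set of cells (`Reach.eq_of_cells_eq`).

Being reduced becomes a condition on each edge of the bottom path (`Good`, `Diagram.isReduced_iff`).
Reduced forms are computed by letting steps act through `toggle`, which either glues a cell or
cancels a dipole. Hence two vertices are adjacent exactly when one arises from the other by gluing a
cell (`Fire`).

Opposite sides of a square glue the same cell (`AreParallelSides.edgeCell_eq`). Conversely, if an
edge glues `c`, any other removable cell of its larger endpoint can be removed from both endpoints,
which gives a parallel edge. Iterating, one arrives at an edge whose larger endpoint `Δ` has `c` as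
its only removable cell (`IsTip`). Such a `Δ` consists of `c` and the cells above `c`, so it depends
on `c` alone, and all edges that glue `c` lie in one hyperplane.

The hyperplane of `c` separates the vertices that contain `c` from the others. An edge outside it
does not change whether `c` is present. A diagram without `c` can be dismantled down to `ε(w)`, and
one with `c` down to `Δ`, in both cases without touching `c`; the latter also exhibits `Δ` as a
prefix. Finally, having a tip is the same as being minimal (`FarleyVertex.isMinimal_of_isTip`,
`FarleyVertex.exists_isTip`). -/

namespace SemigroupPresentation

variable {α : Type*} {P : SemigroupPresentation α} {w : List α}

/-! ### Edges of diagrams with their history -/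

/-- An edge of a diagram, described by its history: it is the `i`-th edge of the top path, or the
`j`-th edge of the bottom path, labelled by `v`, of a cell with top path `t`. In both cases `a` is
the label of the edge. -/
inductive PathEdge (α : Type*) where
  | init (i : ℕ) (a : α)
  | out (t : List (PathEdge α)) (v : List α) (j : ℕ) (a : α)

namespace PathEdge

def label : PathEdge α → α
  | init _ a => a
  | out _ _ _ a => a

def labels (S : List (PathEdge α)) : List α := S.map label

@[simp] theorem labels_append (S T : List (PathEdge α)) :
    labels (S ++ T) = labels S ++ labels T := List.map_append

@[simp] theorem length_labels (S : List (PathEdge α)) : (labels S).length = S.length :=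
  List.length_map _

theorem labels_eq_nil {S : List (PathEdge α)} : labels S = [] ↔ S = [] := List.map_eq_nil_iff

/-- The bottom path of a cell with top path `t` and bottom label `v`. -/
def outs (t : List (PathEdge α)) (v : List α) : List (PathEdge α) :=
  v.zipIdx.map fun p => out t v p.2 p.1

/-- The top path of a diagram with top label `w`. -/
def initPath (w : List α) : List (PathEdge α) := w.zipIdx.map fun p => init p.2 p.1

@[simp] theorem labels_outs (t : List (PathEdge α)) (v : List α) : labels (outs t v) = v := by
  simp [labels, outs, Function.comp_def, label]

@[simp] theorem labels_initPath (w : List α) : labels (initPath w) = w := by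
  simp [labels, initPath, Function.comp_def, label]

theorem mem_outs {e : PathEdge α} {t : List (PathEdge α)} {v : List α} (h : e ∈ outs t v) :
    ∃ j a, e = out t v j a := by
  obtain ⟨p, -, rfl⟩ := List.mem_map.1 h
  exact ⟨_, _, rfl⟩

theorem outs_ne_nil {t : List (PathEdge α)} {v : List α} (hv : v ≠ []) : outs t v ≠ [] := by
  simpa [outs] using hv

theorem exists_mem_outs (t : List (PathEdge α)) {v : List α} (hv : v ≠ []) :
    ∃ j a, out t v j a ∈ outs t v := by
  obtain ⟨e, he⟩ := List.exists_mem_of_ne_nil _ (outs_ne_nil (t := t) hv)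
  obtain ⟨j, a, rfl⟩ := mem_outs he
  exact ⟨j, a, he⟩

theorem eq_of_mem_outs {e : PathEdge α} {t t' : List (PathEdge α)} {v v' : List α}
    (h : e ∈ outs t v) (h' : e ∈ outs t' v') : t = t' ∧ v = v' := by
  obtain ⟨j, a, rfl⟩ := mem_outs h
  obtain ⟨j', a', h⟩ := mem_outs h'
  cases h
  exact ⟨rfl, rfl⟩

theorem nodup_outs (t : List (PathEdge α)) (v : List α) : (outs t v).Nodup := by
  -- The positions alone already distinguish the edges: they form a range.
  have h : ((outs t v).map fun e => match e with | init i _ => i | out _ _ j _ => j).Nodup := by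
    simp [outs, Function.comp_def, List.zipIdx_map_snd, List.nodup_range']
  exact h.of_map _

theorem nodup_initPath (w : List α) : (initPath w).Nodup := by
  have h : ((initPath w).map fun e => match e with | init i _ => i | out _ _ j _ => j).Nodup := by
    simp [initPath, Function.comp_def, List.zipIdx_map_snd, List.nodup_range']
  exact h.of_map _

theorem mem_initPath {e : PathEdge α} (h : e ∈ initPath w) : ∃ i a, e = init i a := by
  obtain ⟨p, -, rfl⟩ := List.mem_map.1 h
  exact ⟨_, _, rfl⟩

end PathEdge

/-! ### Segments of lists -/

section Lists

variable {β : Type*}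

/-- Two non-empty segments of a list overlap, or one of them lies to the left of the other. -/
theorem segment_trichotomy {x m y x' m' y' : List β} (hm : m ≠ []) (hm' : m' ≠ [])
    (h : x ++ m ++ y = x' ++ m' ++ y') :
    (∃ e ∈ m, e ∈ m') ∨ (∃ z, x' = x ++ m ++ z ∧ y = z ++ m' ++ y') ∨
      ∃ z, x = x' ++ m' ++ z ∧ y' = z ++ m ++ y := by
  have aux : ∀ {x m y a m' y' : List β}, m ≠ [] → m' ≠ [] → m ++ y = a ++ (m' ++ y') →
      (∃ e ∈ m, e ∈ m') ∨ ∃ z, x ++ a = x ++ m ++ z ∧ y = z ++ m' ++ y' := by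
    intro x m y a m' y' hm hm' h
    rcases List.append_eq_append_iff.1 h with ⟨b, rfl, h₁⟩ | ⟨b, rfl, h₁⟩
    · exact Or.inr ⟨b, by simp, by simp [h₁]⟩
    · cases b with
      | nil => exact Or.inr ⟨[], by simp, by simpa using Eq.symm h₁⟩
      | cons e b =>
        cases m' with
        | nil => exact absurd rfl hm'
        | cons e' m' =>
          simp only [List.cons_append, List.cons.injEq] at h₁
          exact Or.inl ⟨e, by simp, by simp [h₁.1]⟩
  rw [List.append_assoc, List.append_assoc] at h
  rcases List.append_eq_append_iff.1 h with ⟨a, rfl, h₁⟩ | ⟨a, rfl, h₁⟩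
  · exact (aux hm hm' h₁).imp_right Or.inl
  · rcases aux (x := x') hm' hm h₁ with ⟨e, h₂, h₃⟩ | h₂
    · exact Or.inl ⟨e, h₃, h₂⟩
    · exact Or.inr (Or.inr h₂)

theorem append_inj_of_nodup {x m y x' y' : List β} (hm : m ≠ []) (hn : (x ++ m ++ y).Nodup)
    (h : x ++ m ++ y = x' ++ m ++ y') : x = x' ∧ y = y' := by
  obtain ⟨e, m, rfl⟩ := List.exists_cons_of_ne_nil hm
  have h' : x ++ e :: (m ++ y) = x' ++ e :: (m ++ y') := by simpa using h
  have hn' : (x ++ e :: (m ++ y)).Nodup := by simpa using hn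
  have h₁ := List.nodup_middle.1 hn'
  rw [List.nodup_cons, List.mem_append, not_or] at h₁
  obtain ⟨h₂, -, h₃⟩ := (List.append_cons_inj_of_notMem h₁.1.1 h₁.1.2).1 h'
  exact ⟨h₂, List.append_cancel_left h₃⟩

end Lists

theorem IsCell.ne_nil {u v : List α} (h : P.IsCell u v) : u ≠ [] ∧ v ≠ [] :=
  h.elim P.ne_nil fun h => (P.ne_nil h).symm

/-! ### Actions of derivations and diagrams on paths -/

open PathEdge

/-- The action of a step on a path: the segment `m` replaced by the step becomes `f m s.tgt`. -/
def act (f : List (PathEdge α) → List α → List (PathEdge α)) (S : List (PathEdge α))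
    (s : Step α) : List (PathEdge α) :=
  S.take s.left.length ++ f ((S.drop s.left.length).take s.src.length) s.tgt ++
    S.drop (s.left.length + s.src.length)

def run (f : List (PathEdge α) → List α → List (PathEdge α)) (S : List (PathEdge α))
    (l : List (Step α)) : List (PathEdge α) :=
  l.foldl (act f) S

section Run

variable {f : List (PathEdge α) → List α → List (PathEdge α)}

@[simp] theorem run_nil (S : List (PathEdge α)) : run f S [] = S := rfl

@[simp] theorem run_cons (S : List (PathEdge α)) (s : Step α) (l : List (Step α)) :
    run f S (s :: l) = run f (act f S s) l := rfl

@[simp] theorem run_append (S : List (PathEdge α)) (l l' : List (Step α)) :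
    run f S (l ++ l') = run f (run f S l) l' := List.foldl_append

theorem act_eq {x m y : List (PathEdge α)} {s : Step α} (hx : labels x = s.left)
    (hm : labels m = s.src) : act f (x ++ m ++ y) s = x ++ f m s.tgt ++ y := by
  unfold act
  rw [← hx, ← hm]
  simp

theorem exists_split {S : List (PathEdge α)} {a b c : List α} (h : labels S = a ++ b ++ c) :
    ∃ x m y, S = x ++ m ++ y ∧ labels x = a ∧ labels m = b ∧ labels y = c := by
  obtain ⟨xm, y, rfl, h₁, rfl⟩ := List.map_eq_append_iff.1 h
  obtain ⟨x, m, rfl, rfl, rfl⟩ := List.map_eq_append_iff.1 h₁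
  exact ⟨x, m, y, rfl, rfl, rfl, rfl⟩

theorem IsDerivation.of_append {l l' : List (Step α)} : ∀ {u v : List α},
    P.IsDerivation u (l ++ l') v → ∃ m, P.IsDerivation u l m ∧ P.IsDerivation m l' v := by
  induction l with
  | nil => intro u v h; exact ⟨u, rfl, h⟩
  | cons s l ih =>
    intro u v h
    obtain ⟨m, h₁, h₂⟩ := ih h.2.2
    exact ⟨m, ⟨h.1, h.2.1, h₁⟩, h₂⟩

theorem labels_act (hf : ∀ m v, labels (f m v) = v) {S : List (PathEdge α)} {s : Step α}
    (h : labels S = s.top) : labels (act f S s) = s.bot := by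
  obtain ⟨x, m, y, rfl, hx, hm, hy⟩ := exists_split h
  rw [act_eq hx hm]
  simp [hf, hx, hy, Step.bot]

theorem labels_run (hf : ∀ m v, labels (f m v) = v) {l : List (Step α)} :
    ∀ {u v : List α} {S : List (PathEdge α)}, P.IsDerivation u l v → labels S = u →
      labels (run f S l) = v := by
  induction l with
  | nil => intro u v S h hS; exact hS.trans h
  | cons s l ih =>
    intro u v S h hS
    exact ih h.2.2 (labels_act hf (hS.trans h.2.1.symm))

/-- The two steps replace disjoint segments, so their order is irrelevant. The condition on `f`
keeps labels, hence positions, in agreement with the words of the derivation; it holds for both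
`outs` and `toggle`. -/
theorem run_exchange (hf : ∀ m v, labels (f m v) = v) {l l' : List (Step α)} {u v : List α}
    {S : List (PathEdge α)} (hl : Exchange l l') (h : P.IsDerivation u l v) (hS : labels S = u) :
    run f S l = run f S l' := by
  obtain ⟨l₁, l₂, a, p, q, b, p', q', c⟩ := hl
  obtain ⟨m, h₁, h₂⟩ := h.of_append
  simp only [run_append, run_cons]
  have hm := labels_run hf h₁ hS
  generalize run f S l₁ = T at hm
  obtain ⟨x, t, y, rfl, hx, ht, hy⟩ := exists_split (hm.trans h₂.2.1.symm)
  obtain ⟨z, t', y, rfl, hz, ht', hy⟩ := exists_split hy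
  dsimp only at hx ht hz ht' hy
  congr 1
  rw [act_eq hx ht]
  have e₁ : x ++ f t q ++ (z ++ t' ++ y) = (x ++ f t q ++ z) ++ t' ++ y := by simp
  have e₂ : x ++ t ++ (z ++ t' ++ y) = (x ++ t ++ z) ++ t' ++ y := by simp
  dsimp only
  rw [e₁, e₂, act_eq (by simp [hx, hf, hz]) ht', act_eq (by simp [hx, ht, hz]) ht']
  have e₃ : (x ++ t ++ z) ++ f t' q' ++ y = x ++ t ++ (z ++ f t' q' ++ y) := by simp
  dsimp only
  rw [e₃, act_eq hx ht]
  simp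

theorem Exchange.isDerivation_iff {l l' : List (Step α)} (hl : Exchange l l') {u v : List α} :
    P.IsDerivation u l v ↔ P.IsDerivation u l' v := by
  obtain ⟨l₁, l₂, a, p, q, b, p', q', c⟩ := hl
  constructor
  · intro h
    obtain ⟨m, h₁, h₂, h₃, h₄, h₅, h₆⟩ := h.of_append
    refine h₁.append ⟨h₄, ?_, h₂, ?_, ?_⟩
    · rw [← h₃]; simp [Step.top]
    · simp [Step.top, Step.bot]
    · simpa [Step.bot] using h₆
  · intro h
    obtain ⟨m, h₁, h₂, h₃, h₄, h₅, h₆⟩ := h.of_append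
    refine h₁.append ⟨h₄, ?_, h₂, ?_, ?_⟩
    · rw [← h₃]; simp [Step.top]
    · simp [Step.top, Step.bot]
    · simpa [Step.bot] using h₆

/-- Two lists of steps differ by exchanges. -/
abbrev Isotopic (l l' : List (Step α)) : Prop := Relation.EqvGen Exchange l l'

theorem Isotopic.isDerivation_iff {l l' : List (Step α)} (hl : Isotopic l l') {u v : List α} :
    P.IsDerivation u l v ↔ P.IsDerivation u l' v := by
  induction hl with
  | rel _ _ h => exact h.isDerivation_iff
  | refl => rfl
  | symm _ _ _ ih => exact ih.symm
  | trans _ _ _ _ _ ih ih' => exact ih.trans ih'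

theorem Isotopic.append_right {l l' : List (Step α)} (hl : Isotopic l l') (k : List (Step α)) :
    Isotopic (l ++ k) (l' ++ k) := by
  induction hl with
  | rel _ _ h => exact .rel _ _ (h.append_right k)
  | refl => exact .refl _
  | symm _ _ _ ih => exact .symm _ _ ih
  | trans _ _ _ _ _ ih ih' => exact .trans _ _ _ ih ih'

theorem Isotopic.append_left {l l' : List (Step α)} (hl : Isotopic l l') (k : List (Step α)) :
    Isotopic (k ++ l) (k ++ l') := by
  induction hl with
  | rel _ _ h => exact .rel _ _ (h.append_left k)
  | refl => exact .refl _
  | symm _ _ _ ih => exact .symm _ _ ih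
  | trans _ _ _ _ _ ih ih' => exact .trans _ _ _ ih ih'

theorem Isotopic.length_eq {l l' : List (Step α)} (hl : Isotopic l l') :
    l.length = l'.length := by
  induction hl with
  | rel _ _ h => exact h.length_eq
  | refl => rfl
  | symm _ _ _ ih => exact ih.symm
  | trans _ _ _ _ _ ih ih' => exact ih.trans ih'

namespace Diagram

/-- The chain of exchanges may be taken in raw lists of steps, because exchanges preserve being a
derivation between given words. -/
theorem mk_eq_mk {u v : List α} {d d' : {l : List (Step α) // P.IsDerivation u l v}} :
    (Quot.mk _ d : P.Diagram u v) = Quot.mk _ d' ↔ Isotopic d.1 d'.1 := by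
  constructor
  · intro h
    replace h := Quot.eqvGen_exact h
    induction h with
    | rel _ _ h => exact .rel _ _ h
    | refl => exact .refl _
    | symm _ _ _ ih => exact .symm _ _ ih
    | trans _ _ _ _ _ ih ih' => exact .trans _ _ _ ih ih'
  · suffices ∀ l l', Isotopic l l' → ∀ (h : P.IsDerivation u l v) (h' : P.IsDerivation u l' v),
        (Quot.mk _ ⟨l, h⟩ : P.Diagram u v) = Quot.mk _ ⟨l', h'⟩ from fun h => this _ _ h _ _
    intro l l' hl
    induction hl with
    | rel _ _ h => exact fun _ _ => Quot.sound h
    | refl => exact fun _ _ => rfl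
    | symm _ _ _ ih => exact fun h h' => (ih h' h).symm
    | trans _ _ _ hl _ ih ih' =>
      exact fun h hd => (ih h ((Isotopic.isDerivation_iff hl).1 h)).trans (ih' _ hd)

/-- The action of a diagram on a path labelled by its top path. -/
def run (hf : ∀ m v, labels (f m v) = v) {u v : List α} (S : List (PathEdge α))
    (hS : labels S = u) (Δ : P.Diagram u v) : List (PathEdge α) :=
  Quot.lift (fun d : {l : List (Step α) // P.IsDerivation u l v} =>
    SemigroupPresentation.run f S d.1) (fun d _ h => run_exchange hf h d.2 hS) Δ

theorem labels_run (hf : ∀ m v, labels (f m v) = v) {u v : List α} (S : List (PathEdge α))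
    (hS : labels S = u) (Δ : P.Diagram u v) : labels (Δ.run hf S hS) = v := by
  induction Δ using Quot.ind with | mk d =>
  exact SemigroupPresentation.labels_run hf d.2 hS

theorem run_comp (hf : ∀ m v, labels (f m v) = v) {u v w : List α} (S : List (PathEdge α))
    (hS : labels S = u) (Δ : P.Diagram u v) (Δ' : P.Diagram v w) :
    (Δ.comp Δ').run hf S hS = Δ'.run hf (Δ.run hf S hS) (labels_run hf S hS Δ) := by
  induction Δ using Quot.ind with | mk d =>
  induction Δ' using Quot.ind with | mk d' => exact run_append S d.1 d'.1

end Diagram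

end Run

/-! ### The cells above a path -/

namespace PathEdge

/-- `e` belongs to the top path of the cell that has `f` on its bottom path. -/
def Child (e f : PathEdge α) : Prop := ∃ t v j a, f = out t v j a ∧ e ∈ t

theorem child_out {e : PathEdge α} {t : List (PathEdge α)} {v : List α} {j : ℕ} {a : α} :
    Child e (out t v j a) ↔ e ∈ t := by
  constructor
  · rintro ⟨t', v', j', a', h, he⟩
    cases h
    exact he
  · exact fun h => ⟨t, v, j, a, rfl, h⟩

theorem not_child_init {e : PathEdge α} {i : ℕ} {a : α} : ¬ Child e (init i a) := by
  rintro ⟨t', v', j', a', h, he⟩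
  cases h

/-- The cells of a diagram with bottom path `S`; a cell is described by its top path and the label
of its bottom path. -/
def cells (S : List (PathEdge α)) : Set (List (PathEdge α) × List α) :=
  {c | ∃ f ∈ S, ∃ j a, Relation.ReflTransGen Child (out c.1 c.2 j a) f}

theorem cells_initPath : cells (initPath w) = ∅ := by
  ext c
  simp only [cells, Set.mem_ofPred_eq, Set.mem_empty_iff_false, iff_false]
  rintro ⟨f, hf, j, a, h⟩
  obtain ⟨i, b, rfl⟩ := mem_initPath hf
  rcases h.cases_tail with h | ⟨_, -, h⟩
  · cases h
  · exact not_child_init h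

theorem cells_append (S T : List (PathEdge α)) : cells (S ++ T) = cells S ∪ cells T := by
  ext c
  simp only [cells, Set.mem_ofPred_eq, Set.mem_union, List.mem_append, or_and_right, exists_or]

theorem cells_outs (t : List (PathEdge α)) {v : List α} (hv : v ≠ []) :
    cells (outs t v) = insert (t, v) (cells t) := by
  ext c
  constructor
  · rintro ⟨f, hf, j, a, h⟩
    obtain ⟨j', a', rfl⟩ := mem_outs hf
    rcases h.cases_tail with h | ⟨e, h, h'⟩
    · injection h with h₁ h₂
      exact Or.inl (Prod.ext h₁.symm h₂.symm)
    · exact Or.inr ⟨e, child_out.1 h', j, a, h⟩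
  · obtain ⟨j', a', h'⟩ := exists_mem_outs t hv
    rintro (rfl | ⟨f, hf, j, a, h⟩)
    · exact ⟨_, h', j', a', .refl⟩
    · exact ⟨_, h', j, a, h.tail (child_out.2 hf)⟩

theorem cells_subset_of_mem {S : List (PathEdge α)} {c : List (PathEdge α) × List α}
    (h : c ∈ cells S) : cells c.1 ⊆ cells S := by
  obtain ⟨f, hf, j, a, h⟩ := h
  rintro d ⟨e, he, j', a', h'⟩
  exact ⟨f, hf, j', a', (h'.tail (child_out.2 he)).trans h⟩

end PathEdge

/-! ### Gluing and removing cells -/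

/-- The path `S'` is obtained from `S` by gluing the cell `c` below `S`. -/
def Fire (P : SemigroupPresentation α) (c : List (PathEdge α) × List α)
    (S S' : List (PathEdge α)) : Prop :=
  P.IsCell (labels c.1) c.2 ∧ ∃ x y, S = x ++ c.1 ++ y ∧ S' = x ++ outs c.1 c.2 ++ y

/-- `S` is the bottom path of a diagram with `n` cells and top label `w`. -/
def Reach (P : SemigroupPresentation α) (w : List α) : ℕ → List (PathEdge α) → Prop
  | 0, S => S = initPath w
  | n + 1, S' => ∃ S c, Reach P w n S ∧ P.Fire c S S'

theorem Fire.top_ne_nil {c : List (PathEdge α) × List α} {S S' : List (PathEdge α)}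
    (h : P.Fire c S S') : c.1 ≠ [] := fun h' => h.1.ne_nil.1 (labels_eq_nil.2 h')

/-- The covered segment `c.1` leaves the path, but its cells survive in the history of the new
edges. -/
theorem Fire.cells_eq {c : List (PathEdge α) × List α} {S S' : List (PathEdge α)}
    (h : P.Fire c S S') : cells S' = insert c (cells S) := by
  obtain ⟨hc, x, y, rfl, rfl⟩ := h
  simp only [cells_append, cells_outs c.1 hc.ne_nil.2]
  ext d
  simp only [Set.mem_union, Set.mem_insert_iff]
  tauto

/-- A bottom path is an antichain for the relation of lying above: gluing a cell replaces a segment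
by edges whose ancestors are that segment and what is above it. This is what makes a cell occur only
once in a diagram. -/
theorem Reach.nodup_antichain {n : ℕ} : ∀ {S : List (PathEdge α)}, P.Reach w n S →
    S.Nodup ∧ ∀ e ∈ S, ∀ f ∈ S, ¬ Relation.TransGen Child e f := by
  induction n with
  | zero =>
    rintro S rfl
    refine ⟨nodup_initPath w, fun e _ f hf h => ?_⟩
    obtain ⟨i, a, rfl⟩ := mem_initPath hf
    obtain ⟨_, -, h⟩ := Relation.TransGen.tail'_iff.1 h
    exact not_child_init h
  | succ n ih =>
    rintro S' ⟨S, ⟨t, v⟩, hS, hF⟩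
    obtain ⟨hn, ha⟩ := ih hS
    obtain ⟨e₀, he₀⟩ := List.exists_mem_of_ne_nil _ hF.top_ne_nil
    obtain ⟨hc, x, y, rfl, rfl⟩ := hF
    dsimp only at *
    have hnew : ∀ {j a} {e : PathEdge α}, e ∈ x ++ t ++ y →
        ¬ Relation.ReflTransGen Child (out t v j a) e := by
      intro j a e he h
      exact ha e₀ (by simp [he₀]) e he (Relation.TransGen.head' (child_out.2 he₀) h)
    have hxy : ∀ {e}, e ∈ x ++ y → e ∈ x ++ t ++ y := by
      intro e he
      rcases List.mem_append.1 he with h | h <;> simp [h]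
    -- Order plays no role here, so the replaced segment is moved to the end.
    have hperm : (x ++ outs t v ++ y).Perm (x ++ y ++ outs t v) := by
      rw [List.append_assoc, List.append_assoc]
      exact List.perm_append_comm.append_left x
    have hperm' : (x ++ t ++ y).Perm (x ++ y ++ t) := by
      rw [List.append_assoc, List.append_assoc]
      exact List.perm_append_comm.append_left x
    have hn' := hperm'.nodup_iff.1 hn
    rw [List.nodup_append] at hn'
    constructor
    · rw [hperm.nodup_iff, List.nodup_append]
      refine ⟨hn'.1, nodup_outs t v, ?_⟩
      rintro e he f hf rfl
      obtain ⟨j, a, rfl⟩ := mem_outs hf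
      exact hnew (hxy he) .refl
    · intro e he f hf h
      rw [hperm.mem_iff, List.mem_append] at he hf
      rcases hf with hf | hf
      · rcases he with he | he
        · exact ha e (hxy he) f (hxy hf) h
        · obtain ⟨j, a, rfl⟩ := mem_outs he
          exact hnew (hxy hf) h.to_reflTransGen
      · obtain ⟨j, a, rfl⟩ := mem_outs hf
        obtain ⟨g, hg, hg'⟩ := Relation.TransGen.tail'_iff.1 h
        rw [child_out] at hg'
        have hg'' : g ∈ x ++ t ++ y := by simp [hg']
        rcases he with he | he
        · rcases Relation.reflTransGen_iff_eq_or_transGen.1 hg with rfl | hg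
          · exact hn'.2.2 _ he _ hg' rfl
          · exact ha e (hxy he) g hg'' hg
        · obtain ⟨j, a, rfl⟩ := mem_outs he
          exact hnew hg'' hg

theorem Reach.nodup {n : ℕ} {S : List (PathEdge α)} (h : P.Reach w n S) : S.Nodup :=
  h.nodup_antichain.1

/-- If `c` were already present, some edge of `S` would lie below it, hence below an edge of its top
path, which is in `S` too; this contradicts the antichain property. -/
theorem Fire.notMem_cells {c : List (PathEdge α) × List α} {n : ℕ} {S S' : List (PathEdge α)}
    (h : P.Fire c S S') (hS : P.Reach w n S) : c ∉ cells S := by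
  rintro ⟨f, hf, j, a, h'⟩
  obtain ⟨e, he⟩ := List.exists_mem_of_ne_nil _ h.top_ne_nil
  obtain ⟨-, x, y, rfl, -⟩ := h
  exact hS.nodup_antichain.2 e (by simp [he]) f hf
    (Relation.TransGen.head' (child_out.2 he) h')

theorem exists_fire_of_step {S : List (PathEdge α)} {s : Step α} (hs : P.IsCell s.src s.tgt)
    (h : labels S = s.top) : ∃ x t y, S = x ++ t ++ y ∧ act outs S s = x ++ outs t s.tgt ++ y ∧
      s = ⟨labels x, labels t, s.tgt, labels y⟩ ∧ P.Fire (t, s.tgt) S (act outs S s) := by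
  obtain ⟨x, t, y, rfl, hx, ht, hy⟩ := exists_split h
  refine ⟨x, t, y, rfl, act_eq hx ht, ?_, ?_, x, y, rfl, act_eq hx ht⟩
  · rw [hx, ht, hy]
  · simpa only [ht] using hs

theorem reach_run {l : List (Step α)} : ∀ {b : List α}, P.IsDerivation w l b →
    P.Reach w l.length (run outs (initPath w) l) := by
  induction l using List.reverseRecOn with
  | nil => intro b _; rfl
  | append_singleton l s ih =>
    intro b h
    obtain ⟨m, h₁, h₂, h₃, -⟩ := h.of_append
    obtain ⟨x, t, y, -, -, -, hF⟩ := exists_fire_of_step h₂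
      ((labels_run labels_outs h₁ (labels_initPath w)).trans h₃.symm)
    rw [List.length_append]
    exact ⟨_, _, ih h₁, by simpa using hF⟩

/-- A cell whose whole bottom path is exposed can be glued last. The last step of `l` either glues
this very cell, as soon as the two bottom paths share an edge, or acts on a disjoint segment and can
be exchanged with it. -/
theorem exists_isotopic_append {l : List (Step α)} :
    ∀ {b v : List α} {x t y : List (PathEdge α)}, P.IsDerivation w l b → v ≠ [] →
      run outs (initPath w) l = x ++ outs t v ++ y →
      ∃ l₀, P.IsDerivation w l₀ (labels x ++ labels t ++ labels y) ∧ P.IsCell (labels t) v ∧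
        run outs (initPath w) l₀ = x ++ t ++ y ∧
        Isotopic l (l₀ ++ [⟨labels x, labels t, v, labels y⟩]) := by
  induction l using List.reverseRecOn with
  | nil =>
    intro b v x t y _ hv h
    obtain ⟨j, a, h'⟩ := exists_mem_outs t hv
    have h'' : out t v j a ∈ initPath w := by
      rw [← run_nil (f := outs) (initPath w), h]; simp [h']
    obtain ⟨_, _, h⟩ := mem_initPath h''
    cases h
  | append_singleton l s ih =>
    intro b v x t y hl hv h
    have hn := (reach_run hl).nodup
    obtain ⟨m, h₁, h₂, h₃, h₄⟩ := hl.of_append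
    obtain ⟨x', t', y', hS, hS', hs, -⟩ := exists_fire_of_step h₂
      ((labels_run labels_outs h₁ (labels_initPath w)).trans h₃.symm)
    have hq := h₂.ne_nil.2
    rw [run_append, run_cons, run_nil] at h hn
    rw [hS'] at h hn
    have hd₀ : P.IsDerivation w l (labels (x' ++ t' ++ y')) := by
      rw [← hS, labels_run labels_outs h₁ (labels_initPath w)]; exact h₁
    have hc : P.IsCell (labels t') s.tgt := by rw [hs] at h₂; exact h₂
    -- The equation `hs` mentions `s` on both sides; naming the target allows `s` to be eliminated.
    generalize s.tgt = q at hs hS' h hn hq hc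
    subst hs
    rcases segment_trichotomy (outs_ne_nil hv) (outs_ne_nil hq) h.symm with
      ⟨e, he, he'⟩ | ⟨z, rfl, rfl⟩ | ⟨z, rfl, rfl⟩
    · obtain ⟨rfl, rfl⟩ := eq_of_mem_outs he he'
      obtain ⟨rfl, rfl⟩ := append_inj_of_nodup (outs_ne_nil hv) hn h
      exact ⟨l, by simpa using hd₀, hc, hS, .refl _⟩
    · obtain ⟨l₀, d, hc', hr, hi⟩ := ih (x := x) (t := t) (y := z ++ t' ++ y') h₁ hv
        (by rw [hS]; simp)
      refine ⟨l₀ ++ [⟨labels x ++ labels t ++ labels z, labels t', q, labels y'⟩],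
        d.append ⟨hc, by simp [Step.top], by simp [Step.bot, IsDerivation]⟩, hc', ?_, ?_⟩
      · have e : x ++ t ++ (z ++ t' ++ y') = (x ++ t ++ z) ++ t' ++ y' := by simp
        rw [run_append, run_cons, run_nil, hr, e, act_eq (by simp) rfl]
        simp
      · refine .trans _ _ _ (hi.append_right _) (.rel _ _ ?_)
        simpa using Exchange.mk l₀ [] (labels x) (labels t) v (labels z) (labels t') q (labels y')
    · obtain ⟨l₀, d, hc', hr, hi⟩ := ih (x := x' ++ t' ++ z) (t := t) (y := y) h₁ hv
        (by rw [hS]; simp)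
      refine ⟨l₀ ++ [⟨labels x', labels t', q, labels z ++ labels t ++ labels y⟩],
        d.append ⟨hc, by simp [Step.top], by simp [Step.bot, IsDerivation]⟩, hc', ?_, ?_⟩
      · have e : (x' ++ t' ++ z) ++ t ++ y = x' ++ t' ++ (z ++ t ++ y) := by simp
        rw [run_append, run_cons, run_nil, hr, e, act_eq rfl rfl]
        simp
      · refine .trans _ _ _ (hi.append_right _) (.symm _ _ (.rel _ _ ?_))
        simpa using Exchange.mk l₀ [] (labels x') (labels t') q (labels z) (labels t) v (labels y)

/-- The last cell of `l` is exposed in the common bottom path, so it can also be made the last cell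
of `l'`; both are then peeled off. -/
theorem isotopic_of_run_eq {l : List (Step α)} : ∀ {l' : List (Step α)} {b b' : List α},
    P.IsDerivation w l b → P.IsDerivation w l' b' →
      run outs (initPath w) l = run outs (initPath w) l' → Isotopic l l' := by
  induction l using List.reverseRecOn with
  | nil =>
    intro l' b b' _ h' h
    rcases List.eq_nil_or_concat l' with rfl | ⟨l', s, rfl⟩
    · exact .refl _
    · have hr := reach_run h'
      rw [List.concat_eq_append, List.length_append] at hr
      obtain ⟨S, c, -, hF⟩ := hr
      have hc := hF.cells_eq
      rw [← List.concat_eq_append, ← h, run_nil, cells_initPath] at hc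
      exact absurd hc.symm (Set.insert_nonempty _ _).ne_empty
  | append_singleton l s ih =>
    intro l' b b' hl hl' h
    obtain ⟨m, h₁, h₂, h₃, -⟩ := hl.of_append
    obtain ⟨x, t, y, hS, hS', hs, -⟩ := exists_fire_of_step h₂
      ((labels_run labels_outs h₁ (labels_initPath w)).trans h₃.symm)
    rw [run_append, run_cons, run_nil, hS'] at h
    obtain ⟨l₀, d, -, hr, hi⟩ := exists_isotopic_append hl' h₂.ne_nil.2 h.symm
    rw [← hs] at hi
    exact .trans _ _ _ ((ih h₁ d (hS.trans hr.symm)).append_right _) (.symm _ _ hi)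

theorem Reach.exists_derivation {n : ℕ} : ∀ {S : List (PathEdge α)}, P.Reach w n S →
    ∃ l, l.length = n ∧ P.IsDerivation w l (labels S) ∧ run outs (initPath w) l = S := by
  induction n with
  | zero => rintro S rfl; exact ⟨[], rfl, (labels_initPath w).symm, rfl⟩
  | succ n ih =>
    rintro S' ⟨S, c, hS, hc, x, y, rfl, rfl⟩
    obtain ⟨l, hl, hd, hr⟩ := ih hS
    refine ⟨l ++ [⟨labels x, labels c.1, c.2, labels y⟩], by simp [hl],
      hd.append ⟨hc, by simp [Step.top], by simp [Step.bot, IsDerivation]⟩, ?_⟩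
    rw [run_append, run_cons, run_nil, hr, act_eq rfl rfl]

theorem Reach.unfire {n : ℕ} {c : List (PathEdge α) × List α} {S x y : List (PathEdge α)}
    (h : P.Reach w n S) (hc : c.2 ≠ []) (hS : S = x ++ outs c.1 c.2 ++ y) :
    ∃ m, n = m + 1 ∧ P.Reach w m (x ++ c.1 ++ y) ∧ P.Fire c (x ++ c.1 ++ y) S := by
  obtain ⟨l, rfl, hd, hr⟩ := h.exists_derivation
  obtain ⟨l₀, d, hc', hr', hi⟩ := exists_isotopic_append hd hc (hr.trans hS)
  exact ⟨l₀.length, by simpa using hi.length_eq, hr' ▸ reach_run d, hc', x, y, rfl, hS⟩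

/-- Every cell lies above a cell that can be removed. -/
theorem Reach.exists_removable {n : ℕ} : ∀ {S : List (PathEdge α)} {c : _ × List α},
    P.Reach w n S → c ∈ cells S → ∃ (d : _ × List α) (x y : List (PathEdge α)), d.2 ≠ [] ∧
      S = x ++ outs d.1 d.2 ++ y ∧ (c = d ∨ c ∈ cells d.1) := by
  induction n with
  | zero =>
    rintro S c rfl hc
    rw [cells_initPath] at hc
    exact hc.elim
  | succ n ih =>
    rintro S' c ⟨S, d, hS, hF⟩ hc
    rw [hF.cells_eq] at hc
    have ht := hF.top_ne_nil
    obtain ⟨hd, x, y, rfl, rfl⟩ := hF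
    by_cases hcd : c = d ∨ c ∈ cells d.1
    · exact ⟨d, x, y, hd.ne_nil.2, rfl, hcd⟩
    · have hcS := hc.resolve_left fun h => hcd (Or.inl h)
      obtain ⟨d', x', y', hd', hS', hcd'⟩ := ih hS hcS
      rcases segment_trichotomy ht (outs_ne_nil hd') hS' with
        ⟨e, he, he'⟩ | ⟨z, rfl, rfl⟩ | ⟨z, rfl, rfl⟩
      · refine absurd (Or.inr ?_) hcd
        obtain ⟨j, a, rfl⟩ := mem_outs he'
        have h : d' ∈ cells d.1 := ⟨_, he, j, a, .refl⟩
        rcases hcd' with rfl | hcd'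
        · exact h
        · exact cells_subset_of_mem h hcd'
      · exact ⟨d', x ++ outs d.1 d.2 ++ z, y', hd', by simp, hcd'⟩
      · exact ⟨d', x', z ++ outs d.1 d.2 ++ y, hd', by simp, hcd'⟩

/-- No cell lies below a removable one, since a removable cell may be assumed to be glued last. -/
theorem Reach.notMem_cells_of_mem {n : ℕ} {S : List (PathEdge α)} {c d : _ × List α}
    {x y : List (PathEdge α)} (h : P.Reach w n S) (hc : c.2 ≠ [])
    (hS : S = x ++ outs c.1 c.2 ++ y) (hd : d ∈ cells S) : c ∉ cells d.1 := by
  obtain ⟨m, -, hr, hF⟩ := h.unfire hc hS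
  have hn := hF.notMem_cells hr
  rw [hF.cells_eq] at hd
  rcases hd with rfl | hd
  · exact fun h' => hn (by simp only [cells_append]; exact Or.inl (Or.inr h'))
  · exact fun h' => hn (cells_subset_of_mem hd h')

/-- The last cell `d` of one diagram lies above no other cell; this depends only on the common set
of cells, so `d` is removable from the other diagram as well. Removing it from both reduces the
number of cells. -/
theorem Reach.eq_of_cells_eq {n : ℕ} : ∀ {n' : ℕ} {S S' : List (PathEdge α)},
    P.Reach w n S → P.Reach w n' S' → cells S = cells S' → S = S' := by
  induction n with
  | zero =>
    rintro (_ | n') S S' rfl h' h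
    · exact Eq.symm h'
    · obtain ⟨S₀, c, -, hF⟩ := h'
      rw [hF.cells_eq, cells_initPath] at h
      exact absurd h.symm (Set.insert_nonempty _ _).ne_empty
  | succ n ih =>
    rintro n' S S' h h' hcells
    have hr := h
    obtain ⟨S₀, d, hS₀, hF⟩ := h
    have hd : d ∈ cells S' := by rw [← hcells, hF.cells_eq]; exact Set.mem_insert _ _
    have hd' := hF.notMem_cells hS₀
    have hcS := hF.cells_eq
    have ht := hF.top_ne_nil
    obtain ⟨hc, x, y, rfl, rfl⟩ := hF
    obtain ⟨d', x', y', hne, hS', hdd⟩ := h'.exists_removable hd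
    have hdd' : d = d' := by
      refine hdd.resolve_right (hr.notMem_cells_of_mem hc.ne_nil.2 rfl ?_)
      rw [hcells, hS']
      simp only [cells_append, cells_outs _ hne]
      exact Or.inl (Or.inr (Or.inl rfl))
    subst hdd'
    obtain ⟨m, -, hr', hF'⟩ := h'.unfire hne hS'
    have h₁ : x ++ d.1 ++ y = x' ++ d.1 ++ y' := by
      refine ih hS₀ hr' ?_
      rw [hcS, hF'.cells_eq] at hcells
      -- Since `d` is new on both sides, deleting it recovers the two smaller sets of cells.
      rw [← Set.insert_sdiff_self_of_notMem hd', hcells,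
        Set.insert_sdiff_self_of_notMem (hF'.notMem_cells hr')]
    obtain ⟨rfl, rfl⟩ := append_inj_of_nodup ht hS₀.nodup h₁
    exact hS'.symm

/-! ### Diagrams with a single removable cell -/

/-- `c` is the only cell that can be removed from the diagram with bottom path `S`. -/
def IsTip (c : List (PathEdge α) × List α) (S : List (PathEdge α)) : Prop :=
  c ∈ cells S ∧ ∀ (d : _ × List α) (x y : List (PathEdge α)), d.2 ≠ [] →
    S = x ++ outs d.1 d.2 ++ y → d = c

/-- Every cell lies above a removable one, and `c` is the only candidate. Hence the diagram is
determined by `c`. -/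
theorem IsTip.cells_eq {c : List (PathEdge α) × List α} {n : ℕ} {S : List (PathEdge α)}
    (h : IsTip c S) (hS : P.Reach w n S) : cells S = insert c (cells c.1) := by
  ext c'
  constructor
  · intro hc'
    obtain ⟨d, x, y, hd, hxy, hcd⟩ := hS.exists_removable hc'
    rw [← h.2 d x y hd hxy]
    exact hcd
  · rintro (rfl | hc')
    · exact h.1
    · exact cells_subset_of_mem h.1 hc'

theorem IsTip.unique {c : List (PathEdge α) × List α} {n n' : ℕ} {S S' : List (PathEdge α)}
    (h : IsTip c S) (h' : IsTip c S') (hS : P.Reach w n S) (hS' : P.Reach w n' S') : S = S' :=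
  hS.eq_of_cells_eq hS' ((h.cells_eq hS).trans (h'.cells_eq hS').symm)

theorem IsTip.exists_eq {c : List (PathEdge α) × List α} {n : ℕ} {S : List (PathEdge α)}
    (h : IsTip c S) (hS : P.Reach w n S) : c.2 ≠ [] ∧ ∃ x y, S = x ++ outs c.1 c.2 ++ y := by
  obtain ⟨d, x, y, hd, hxy, -⟩ := hS.exists_removable h.1
  obtain rfl := h.2 d x y hd hxy
  exact ⟨hd, x, y, hxy⟩

/-! ### Dipoles and reduced forms -/

namespace PathEdge

/-- No dipole occurs among the cells above the edge. -/
inductive Good : PathEdge α → Prop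
  | init (i : ℕ) (a : α) : Good (init i a)
  | out (t : List (PathEdge α)) (v : List α) (j : ℕ) (a : α) : (∀ e ∈ t, Good e) →
      (∀ t', t = outs t' (labels t) → labels t' ≠ v) → Good (out t v j a)

theorem good_out {t : List (PathEdge α)} {v : List α} {j : ℕ} {a : α} :
    Good (out t v j a) ↔
      (∀ e ∈ t, Good e) ∧ ∀ t', t = outs t' (labels t) → labels t' ≠ v := by
  constructor
  · intro h
    cases h with | out _ _ _ _ h h' => exact ⟨h, h'⟩
  · exact fun h => .out t v j a h.1 h.2

theorem outs_inj_left {t t' : List (PathEdge α)} {v : List α} (hv : v ≠ [])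
    (h : outs t v = outs t' v) : t = t' := by
  obtain ⟨j, a, h'⟩ := exists_mem_outs t hv
  exact (eq_of_mem_outs h' (h ▸ h')).1

open Classical in
/-- The path that replaces `m` when a cell with bottom label `v` is glued below `m` and the dipole
is reduced that may arise. -/
noncomputable def toggle (m : List (PathEdge α)) (v : List α) : List (PathEdge α) :=
  if h : ∃ t, m = outs t (labels m) ∧ labels t = v then h.choose else outs m v

@[simp] theorem labels_toggle (m : List (PathEdge α)) (v : List α) : labels (toggle m v) = v := by
  unfold toggle
  split_ifs with h
  · exact h.choose_spec.2
  · exact labels_outs m v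

theorem toggle_outs (t : List (PathEdge α)) {u : List α} (hu : u ≠ []) :
    toggle (outs t u) (labels t) = t := by
  have h : ∃ t', outs t u = outs t' (labels (outs t u)) ∧ labels t' = labels t :=
    ⟨t, by rw [labels_outs], rfl⟩
  unfold toggle
  rw [dif_pos h]
  have h' := h.choose_spec.1
  generalize h.choose = t' at h'
  rw [labels_outs] at h'
  exact (outs_inj_left hu h').symm

theorem toggle_eq {m : List (PathEdge α)} {v : List α}
    (h : ∀ t, m = outs t (labels m) → labels t ≠ v) : toggle m v = outs m v := by
  unfold toggle
  rw [dif_neg]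
  rintro ⟨t, h₁, h₂⟩
  exact h t h₁ h₂

theorem toggle_cases {m : List (PathEdge α)} (hm : labels m ≠ []) (v : List α) :
    (toggle m v = outs m v ∧ ∀ t, m = outs t (labels m) → labels t ≠ v) ∨
      (m = outs (toggle m v) (labels m)) := by
  by_cases h : ∃ t, m = outs t (labels m) ∧ labels t = v
  · obtain ⟨t, h₁, rfl⟩ := h
    right
    have h₂ := toggle_outs t hm
    rw [← h₁] at h₂
    rw [h₂]
    exact h₁
  · push Not at h
    exact Or.inl ⟨toggle_eq h, h⟩

theorem good_toggle {m : List (PathEdge α)} (hm : labels m ≠ []) (v : List α)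
    (h : ∀ e ∈ m, Good e) : ∀ e ∈ toggle m v, Good e := by
  rcases toggle_cases hm v with ⟨h', h''⟩ | h'
  · rw [h']
    intro e he
    obtain ⟨j, a, rfl⟩ := mem_outs he
    exact good_out.2 ⟨h, h''⟩
  · obtain ⟨j, a, h''⟩ := exists_mem_outs (toggle m v) hm
    rw [← h'] at h''
    exact (good_out.1 (h _ h'')).1

/-- This invariance under dipoles is where goodness enters: after `toggle` has cancelled a cell,
gluing that cell again must not cancel yet another one, and this would require a dipole in the
history of `m`. -/
theorem toggle_toggle {m : List (PathEdge α)} (hm : labels m ≠ []) {v : List α} (hv : v ≠ [])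
    (h : ∀ e ∈ m, Good e) : toggle (toggle m v) (labels m) = m := by
  rcases toggle_cases hm v with ⟨h', h''⟩ | h'
  · rw [h', toggle_outs m hv]
  · obtain ⟨j, a, h''⟩ := exists_mem_outs (toggle m v) hm
    rw [← h'] at h''
    rw [toggle_eq (good_out.1 (h _ h'')).2, ← h']

end PathEdge

theorem good_act_toggle {S : List (PathEdge α)} {s : Step α} (hs : P.IsCell s.src s.tgt)
    (hS : labels S = s.top) (h : ∀ e ∈ S, Good e) : ∀ e ∈ act toggle S s, Good e := by
  obtain ⟨x, m, y, rfl, hx, hm, hy⟩ := exists_split hS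
  rw [act_eq hx hm]
  intro e he
  rw [List.mem_append, List.mem_append] at he
  rcases he with (he | he) | he
  · exact h e (by simp [he])
  · exact good_toggle (hm ▸ hs.ne_nil.1) _ (fun e he => h e (by simp [he])) e he
  · exact h e (by simp [he])

theorem good_run_toggle {l : List (Step α)} : ∀ {u v : List α} {S : List (PathEdge α)},
    P.IsDerivation u l v → labels S = u → (∀ e ∈ S, Good e) →
      ∀ e ∈ run toggle S l, Good e := by
  induction l with
  | nil => intro u v S _ _ h; exact h
  | cons s l ih =>
    intro u v S hl hS h
    exact ih hl.2.2 (labels_act labels_toggle (hS.trans hl.2.1.symm))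
      (good_act_toggle hl.1 (hS.trans hl.2.1.symm) h)

theorem Fire.good {c : List (PathEdge α) × List α} {S S' : List (PathEdge α)}
    (h : P.Fire c S S') (hg : ∀ e ∈ S', Good e) : ∀ e ∈ S, Good e := by
  obtain ⟨hc, x, y, rfl, rfl⟩ := h
  obtain ⟨j, a, h⟩ := exists_mem_outs c.1 hc.ne_nil.2
  intro e he
  rw [List.mem_append, List.mem_append] at he
  rcases he with (he | he) | he
  · exact hg e (by simp [he])
  · exact (good_out.1 (hg (.out c.1 c.2 j a) (by simp [h]))).1 e he
  · exact hg e (by simp [he])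

theorem good_of_good_run {l : List (Step α)} : ∀ {u v : List α} {S : List (PathEdge α)},
    P.IsDerivation u l v → labels S = u → (∀ e ∈ run outs S l, Good e) → ∀ e ∈ S, Good e := by
  induction l with
  | nil => intro u v S _ _ h; exact h
  | cons s l ih =>
    intro u v S hl hS h
    obtain ⟨x, t, y, -, -, -, hF⟩ := exists_fire_of_step hl.1 (hS.trans hl.2.1.symm)
    exact hF.good (ih hl.2.2 (labels_act labels_outs (hS.trans hl.2.1.symm)) h)

theorem good_initPath : ∀ e ∈ initPath w, Good e := by
  intro e he
  obtain ⟨i, a, rfl⟩ := mem_initPath he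
  exact .init i a

namespace Diagram

theorem comp_assoc {u v x y : List α} (Δ₁ : P.Diagram u v) (Δ₂ : P.Diagram v x)
    (Δ₃ : P.Diagram x y) : (Δ₁.comp Δ₂).comp Δ₃ = Δ₁.comp (Δ₂.comp Δ₃) := by
  induction Δ₁ using Quot.ind with | mk d₁ =>
  induction Δ₂ using Quot.ind with | mk d₂ =>
  induction Δ₃ using Quot.ind with | mk d₃ =>
  exact congrArg (Quot.mk _) (Subtype.ext (List.append_assoc _ _ _))

theorem comp_trivial {u v : List α} (Δ : P.Diagram u v) : Δ.comp (trivial P v) = Δ := by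
  induction Δ using Quot.ind with | mk d =>
  exact congrArg (Quot.mk _) (Subtype.ext (List.append_nil _))

theorem trivial_comp {u v : List α} (Δ : P.Diagram u v) : (trivial P u).comp Δ = Δ := by
  induction Δ using Quot.ind with | mk d => rfl

theorem IsReduced.of_comp {u v x : List α} {Δ₁ : P.Diagram u v} {Δ₂ : P.Diagram v x}
    (h : (Δ₁.comp Δ₂).IsReduced) : Δ₁.IsReduced := by
  rintro Δ' ⟨p, a, b, q, hc, A, B, rfl, rfl⟩
  exact h _ ⟨p, a, b, q, hc, A, B.comp Δ₂, by simp only [comp_assoc], rfl⟩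

theorem run_congr {f : List (PathEdge α) → List α → List (PathEdge α)}
    (hf : ∀ m v, labels (f m v) = v) {u v : List α} {S S' : List (PathEdge α)} (h : S = S')
    (hS : labels S = u) (hS' : labels S' = u) (Δ : P.Diagram u v) :
    Δ.run hf S hS = Δ.run hf S' hS' := by
  subst h
  rfl

/-- The bottom path of a diagram. -/
def botPath {u v : List α} (Δ : P.Diagram u v) : List (PathEdge α) :=
  Δ.run labels_outs (initPath u) (labels_initPath u)

/-- The bottom path of the reduced form of a diagram. -/
noncomputable def reducedBotPath {u v : List α} (Δ : P.Diagram u v) : List (PathEdge α) :=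
  Δ.run labels_toggle (initPath u) (labels_initPath u)

theorem good_reducedBotPath {u v : List α} (Δ : P.Diagram u v) :
    ∀ e ∈ Δ.reducedBotPath, Good e := by
  induction Δ using Quot.ind with | mk d =>
  exact good_run_toggle d.2 (labels_initPath u) good_initPath

/-- The two steps of a dipole act as mutually inverse toggles. Thus `reducedBotPath` is an invariant
of dipole reduction, which replaces a confluence argument. -/
theorem ReducesDipole.reducedBotPath_eq {u v : List α} {Δ Δ' : P.Diagram u v}
    (h : Δ.ReducesDipole Δ') : Δ.reducedBotPath = Δ'.reducedBotPath := by
  obtain ⟨p, a, b, q, hc, A, B, rfl, rfl⟩ := h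
  have hA := good_reducedBotPath A
  unfold reducedBotPath at *
  simp only [run_comp]
  refine run_congr _ ?_ _ _ _
  have hl := labels_run labels_toggle (initPath u) (labels_initPath u) A
  change act toggle (act toggle (A.run labels_toggle (initPath u) (labels_initPath u))
    ⟨p, a, b, q⟩) ⟨p, b, a, q⟩ = _
  generalize A.run labels_toggle (initPath u) (labels_initPath u) = S at hA hl ⊢
  obtain ⟨x, m, y, rfl, hx, hm, hy⟩ := exists_split hl
  rw [act_eq hx hm]
  dsimp only
  rw [act_eq (m := toggle m b) hx (labels_toggle m b)]
  dsimp only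
  rw [← hm, toggle_toggle (hm ▸ hc.ne_nil.1) hc.ne_nil.2 fun e he => hA e (by simp [he])]

theorem IsReduced.reducedBotPath_eq {u v : List α} {Δ : P.Diagram u v} (h : Δ.IsReduced) :
    Δ.reducedBotPath = Δ.botPath := by
  induction Δ using Quot.ind with | mk d =>
  obtain ⟨l, hl⟩ := d
  change SemigroupPresentation.run toggle (initPath u) l =
    SemigroupPresentation.run outs (initPath u) l
  induction l using List.reverseRecOn generalizing v with
  | nil => rfl
  | append_singleton l s ih =>
    obtain ⟨m, h₁, h₂⟩ := hl.of_append
    have hr : IsReduced (Quot.mk _ ⟨l, h₁⟩ : P.Diagram u m) :=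
      IsReduced.of_comp (Δ₁ := Quot.mk _ ⟨l, h₁⟩) (Δ₂ := Quot.mk _ ⟨[s], h₂⟩) h
    rw [run_append, run_append, ih h₁ hr, run_cons, run_cons, run_nil, run_nil]
    obtain ⟨h₂, h₃, h₄⟩ := h₂
    obtain ⟨x, t, y, hS, hS', hs, -⟩ := exists_fire_of_step h₂
      ((SemigroupPresentation.labels_run labels_outs h₁ (labels_initPath u)).trans h₃.symm)
    rw [hS', hS, act_eq (by rw [hs]) (by rw [hs]), toggle_eq]
    -- If the last step cancelled a cell, that cell could be glued immediately before it, which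
    -- would exhibit a dipole.
    rintro t' h₅ h₆
    rw [h₅] at hS
    have ht : labels t ≠ [] := by rw [hs] at h₂; exact h₂.ne_nil.1
    obtain ⟨l₀, d, hc, -, hi⟩ := exists_isotopic_append h₁ ht hS
    rw [← h₆] at hs
    subst hs
    cases h₄
    refine h (Quot.mk _ ⟨l₀, d⟩) ⟨labels x, labels t', labels t, labels y, hc, Quot.mk _ ⟨l₀, d⟩,
      trivial P _, ?_, (comp_trivial _).symm⟩
    refine mk_eq_mk.2 ?_
    simpa using hi.append_right [⟨labels x, labels t, labels t', labels y⟩]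

theorem isReduced_iff {u v : List α} {Δ : P.Diagram u v} :
    Δ.IsReduced ↔ ∀ e ∈ Δ.botPath, Good e := by
  constructor
  · intro h
    rw [← h.reducedBotPath_eq]
    exact good_reducedBotPath Δ
  · rintro h Δ' ⟨p, a, b, q, hc, A, B, rfl, -⟩
    unfold botPath at h
    simp only [run_comp] at h
    have hl := labels_run labels_outs (initPath u) (labels_initPath u) A
    induction B using Quot.ind with | mk B =>
    have h' := good_of_good_run B.2 (labels_run labels_outs _ _ _) h
    change ∀ e ∈ act outs (act outs (A.run labels_outs (initPath u) (labels_initPath u))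
      ⟨p, a, b, q⟩) ⟨p, b, a, q⟩, Good e at h'
    clear h
    generalize A.run labels_outs (initPath u) (labels_initPath u) = S at h' hl
    obtain ⟨x, m, y, rfl, hx, hm, hy⟩ := exists_split hl
    rw [act_eq hx hm] at h'
    dsimp only at h'
    rw [act_eq (m := outs m b) hx (labels_outs m b)] at h'
    obtain ⟨j, c, hj⟩ := exists_mem_outs (outs m b) hc.ne_nil.1
    exact (good_out.1 (h' (.out (outs m b) a j c) (by simp [hj]))).2 m (by rw [labels_outs]) hm

theorem IsReducedForm.reducedBotPath_eq {u v : List α} {Δ R : P.Diagram u v}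
    (h : Δ.IsReducedForm R) : Δ.reducedBotPath = R.botPath := by
  rw [← h.1.reducedBotPath_eq]
  obtain ⟨-, h⟩ := h
  induction h with
  | refl => rfl
  | tail _ h₁ ih => exact ih.trans h₁.reducedBotPath_eq

theorem eq_of_botPath_eq {u v : List α} {Δ Δ' : P.Diagram u v} (h : Δ.botPath = Δ'.botPath) :
    Δ = Δ' := by
  induction Δ using Quot.ind with | mk d =>
  induction Δ' using Quot.ind with | mk d' =>
  exact mk_eq_mk.2 (isotopic_of_run_eq d.2 d'.2 h)

end Diagram

/-! ### Vertices as good paths -/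

namespace FarleyVertex

/-- The bottom path of a vertex. -/
def state (D : P.FarleyVertex w) : List (PathEdge α) := D.diagram.botPath

theorem labels_state (D : P.FarleyVertex w) : labels D.state = D.bot :=
  Diagram.labels_run labels_outs _ (labels_initPath w) D.diagram

theorem state_injective : Function.Injective (state (P := P) (w := w)) := by
  intro D E h
  have hb : D.bot = E.bot := by rw [← labels_state, h, labels_state]
  obtain ⟨b, D, hD⟩ := D
  obtain ⟨b', E, hE⟩ := E
  dsimp only at hb
  subst hb
  obtain rfl := Diagram.eq_of_botPath_eq h
  rfl

theorem good_state (D : P.FarleyVertex w) : ∀ e ∈ D.state, Good e :=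
  Diagram.isReduced_iff.1 D.isReduced

theorem exists_reach (D : P.FarleyVertex w) : ∃ n, P.Reach w n D.state := by
  obtain ⟨b, D, hD⟩ := D
  induction D using Quot.ind with | mk d =>
  exact ⟨_, reach_run d.2⟩

theorem exists_state_eq {n : ℕ} {S : List (PathEdge α)} (h : P.Reach w n S)
    (hS : ∀ e ∈ S, Good e) : ∃ D : P.FarleyVertex w, D.state = S := by
  obtain ⟨l, -, hl, rfl⟩ := h.exists_derivation
  exact ⟨⟨_, Quot.mk _ ⟨l, hl⟩, Diagram.isReduced_iff.2 hS⟩, rfl⟩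

theorem IsProduct.state_eq {D E : P.FarleyVertex w} {x : List α} {Γ : P.Diagram D.bot x}
    (h : D.IsProduct Γ E) : E.state = Γ.run labels_toggle D.state D.labels_state := by
  obtain ⟨R, h, rfl⟩ := h
  refine h.reducedBotPath_eq.symm.trans ?_
  refine (Diagram.run_comp labels_toggle _ _ _ _).trans ?_
  exact Diagram.run_congr _ D.isReduced.reducedBotPath_eq _ _ _

theorem isProduct_of_run {D E : P.FarleyVertex w} {l : List (Step α)} {x : List α}
    (hl : P.IsDerivation D.bot l x) (h : run outs D.state l = E.state) :
    D.IsProduct (Quot.mk _ ⟨l, hl⟩) E := by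
  have hx : x = E.bot := by
    rw [← E.labels_state, ← h, SemigroupPresentation.labels_run labels_outs hl D.labels_state]
  subst hx
  have h' : D.diagram.comp (Quot.mk _ ⟨l, hl⟩) = E.diagram :=
    Diagram.eq_of_botPath_eq ((Diagram.run_comp labels_outs _ _ _ _).trans h)
  exact ⟨E.diagram, ⟨E.isReduced, h' ▸ .refl⟩, rfl⟩

end FarleyVertex

theorem cells_subset_run {l : List (Step α)} : ∀ {u v : List α} {S : List (PathEdge α)},
    P.IsDerivation u l v → labels S = u → cells S ⊆ cells (run outs S l) := by
  induction l with
  | nil => intro u v S _ _; exact subset_rfl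
  | cons s l ih =>
    intro u v S hl hS
    obtain ⟨x, t, y, -, -, -, hF⟩ := exists_fire_of_step hl.1 (hS.trans hl.2.1.symm)
    refine subset_trans ?_ (ih hl.2.2 (labels_act labels_outs (hS.trans hl.2.1.symm)))
    rw [hF.cells_eq]
    exact Set.subset_insert _ _

theorem Fire.exists_step {c : List (PathEdge α) × List α} {S S' : List (PathEdge α)}
    (h : P.Fire c S S') : ∃ s, P.IsDerivation (labels S) [s] (labels S') ∧ act outs S s = S' := by
  obtain ⟨hc, x, y, rfl, rfl⟩ := h
  exact ⟨⟨labels x, labels c.1, c.2, labels y⟩, ⟨hc, by simp [Step.top], by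
    simp [Step.bot, IsDerivation]⟩, act_eq rfl rfl⟩

/-! ### Atomic and thin diagrams -/

namespace Diagram

theorem exists_mk {u v : List α} (Δ : P.Diagram u v) :
    ∃ (l : List (Step α)) (h : P.IsDerivation u l v), l.length = Δ.numCells ∧
      Δ = Quot.mk _ ⟨l, h⟩ := by
  induction Δ using Quot.ind with | mk d => exact ⟨d.1, d.2, rfl, rfl⟩

theorem IsAtomic.exists_mk {u v : List α} {Δ : P.Diagram u v} (hΔ : Δ.IsAtomic) :
    ∃ (s : Step α) (h : P.IsDerivation u [s] v), Δ = Quot.mk _ ⟨[s], h⟩ := by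
  obtain ⟨l, h, hl, rfl⟩ := Δ.exists_mk
  obtain ⟨s, rfl⟩ := List.length_eq_one_iff.1 (hl.trans hΔ)
  exact ⟨s, h, rfl⟩

theorem isThin_congr {u v u' v' : List α} {l l' : List (Step α)} {h : P.IsDerivation u l v}
    {h' : P.IsDerivation u' l' v'} (hu : u = u') (hv : v = v') (hl : l = l')
    (ht : IsThin (Quot.mk _ ⟨l, h⟩ : P.Diagram u v)) :
    IsThin (Quot.mk _ ⟨l', h'⟩ : P.Diagram u' v') := by
  subst hu hv hl
  exact ht

theorem isThin_singleton {u v : List α} {s : Step α} (h : P.IsDerivation u [s] v) :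
    IsThin (Quot.mk _ ⟨[s], h⟩ : P.Diagram u v) := by
  refine isThin_congr (List.append_nil u) (List.append_nil v) ?_
    (IsThin.sum (Quot.mk _ ⟨[s], h⟩) (trivial P []) rfl (.trivial []))
  simp [Step.whisker]

theorem isThin_pair {u v : List α} {a p q b p' q' c : List α}
    (h : P.IsDerivation u [⟨a, p, q, b ++ p' ++ c⟩, ⟨a ++ q ++ b, p', q', c⟩] v) :
    IsThin (Quot.mk _ ⟨_, h⟩ : P.Diagram u v) := by
  obtain ⟨h₁, h₂, h₃, -, h₄⟩ := h
  have d₁ : P.IsDerivation (a ++ p) [⟨a, p, q, []⟩] (a ++ q) :=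
    ⟨h₁, by simp [Step.top], by simp [Step.bot, IsDerivation]⟩
  have d₂ : P.IsDerivation (b ++ p' ++ c) [⟨b, p', q', c⟩] (b ++ q' ++ c) := ⟨h₃, rfl, rfl⟩
  refine isThin_congr ?_ ?_ ?_ (IsThin.sum (Quot.mk _ ⟨_, d₁⟩) _ rfl (isThin_singleton d₂))
  · rw [← h₂]; simp [Step.top]
  · rw [← h₄]; simp [Step.bot]
  · simp [Step.whisker]

theorem IsThin.exists_pair {u v : List α} {Γ : P.Diagram u v} (hΓ : Γ.IsThin)
    (hn : Γ.numCells = 2) : ∃ (a p q b p' q' c : List α)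
      (h : P.IsDerivation u [⟨a, p, q, b ++ p' ++ c⟩, ⟨a ++ q ++ b, p', q', c⟩] v),
      Γ = Quot.mk _ ⟨_, h⟩ := by
  cases hΓ with
  | trivial => cases hn
  | @sum u v u' v' A Γ hA hΓ =>
    obtain ⟨s, h, rfl⟩ := hA.exists_mk
    obtain ⟨l, h', hl, rfl⟩ := Γ.exists_mk
    have hl' : 1 + l.length = 2 := by
      rw [← hn, Nat.add_comm]
      exact (by simp : l.length + 1 =
        ([s].map (Step.whisker [] u') ++ l.map (Step.whisker v [])).length)
    obtain ⟨s', rfl⟩ := List.length_eq_one_iff.1 (by omega : l.length = 1)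
    have e : [s].map (Step.whisker [] u') ++ [s'].map (Step.whisker v []) =
        [⟨s.left, s.src, s.tgt, (s.right ++ s'.left) ++ s'.src ++ s'.right⟩,
          ⟨s.left ++ s.tgt ++ (s.right ++ s'.left), s'.src, s'.tgt, s'.right⟩] := by
      obtain ⟨-, -, rfl⟩ := h
      obtain ⟨-, rfl, -⟩ := h'
      simp [Step.whisker, Step.bot, Step.top]
    refine ⟨s.left, s.src, s.tgt, s.right ++ s'.left, s'.src, s'.tgt, s'.right, ?_, ?_⟩
    · rw [← e]
      have d := h.whisker [] u'
      have d' := h'.whisker v []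
      simp only [List.nil_append, List.append_nil] at d d'
      exact d.append d'
    · exact congrArg (Quot.mk _) (Subtype.ext e)

/-- The leftmost cell of a sum may be glued after all the others. -/
theorem isotopic_whisker {s : Step α} {l : List (Step α)} : ∀ {u u' : List α},
    P.IsDerivation u l u' →
    Isotopic (s.whisker [] u :: l.map (Step.whisker s.bot []))
      (l.map (Step.whisker s.top []) ++ [s.whisker [] u']) := by
  induction l with
  | nil => rintro u u' rfl; exact .refl _
  | cons r l ih =>
    rintro u u' ⟨-, rfl, h⟩
    refine .trans _ _ _ (.rel _ _ ?_) ((ih h).append_left [r.whisker s.top []])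
    simpa [Step.whisker, Step.top, Step.bot] using
      Exchange.mk [] (l.map (Step.whisker s.bot [])) s.left s.src s.tgt (s.right ++ r.left)
        r.src r.tgt r.right

/-- Two different cells can be split off from a thin diagram with several cells. -/
theorem IsThin.exists_two {u v : List α} {Γ : P.Diagram u v} (hΓ : Γ.IsThin)
    (hn : 2 ≤ Γ.numCells) : ∃ (l₁ l₂ : List (Step α)) (s₁ s₂ : Step α)
      (h₁ : P.IsDerivation u (l₁ ++ [s₁]) v) (h₂ : P.IsDerivation u (l₂ ++ [s₂]) v),
      Γ = Quot.mk _ ⟨_, h₁⟩ ∧ Γ = Quot.mk _ ⟨_, h₂⟩ ∧ s₁.left.length < s₂.left.length := by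
  cases hΓ with
  | trivial => cases hn
  | @sum u v u' v' A Γ hA hΓ =>
    obtain ⟨s, h, rfl⟩ := hA.exists_mk
    obtain ⟨l, h', hl, rfl⟩ := Γ.exists_mk
    have hl' : 2 ≤ 1 + l.length := by
      rw [Nat.add_comm]
      exact hn.trans_eq (by simp :
        ([s].map (Step.whisker [] u') ++ l.map (Step.whisker v [])).length = l.length + 1)
    have d := h.whisker [] u'
    have d' := h'.whisker v []
    simp only [List.nil_append, List.append_nil] at d d'
    have d := d.append d'
    have hi := isotopic_whisker (s := s) h'
    obtain ⟨hc, rfl, rfl⟩ := h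
    rcases List.eq_nil_or_concat l with rfl | ⟨l, s', rfl⟩
    · simp at hl'
    rw [List.concat_eq_append] at d h' hi
    have e : [s].map (Step.whisker [] u') ++ (l ++ [s']).map (Step.whisker s.bot []) =
        (s.whisker [] u' :: l.map (Step.whisker s.bot [])) ++ [s'.whisker s.bot []] := by simp
    refine ⟨_, _, _, _, (Isotopic.isDerivation_iff hi).1 d, e ▸ d, mk_eq_mk.2 ?_,
      congrArg (Quot.mk _) (Subtype.ext ?_), ?_⟩
    · simpa using hi
    · simp
    -- The cell that is last in the original order lies to the right of the non-empty bottom path of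
    -- the first summand.
    · have := List.length_pos_iff.2 hc.ne_nil.2
      simp [Step.whisker, Step.bot]
      omega

/-- The isotopy class of a sum of two cells contains only the two obvious orders, which lists the
prefixes spanning a square. Non-empty sources prevent any further exchange. -/
theorem isotopic_pair_iff {a p q b p' q' c : List α} (hp : p ≠ []) (hp' : p' ≠ [])
    {l l' : List (Step α)} (h : Isotopic l l') :
    (l = [⟨a, p, q, b ++ p' ++ c⟩, ⟨a ++ q ++ b, p', q', c⟩] ∨
      l = [⟨a ++ p ++ b, p', q', c⟩, ⟨a, p, q, b ++ q' ++ c⟩]) ↔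
    (l' = [⟨a, p, q, b ++ p' ++ c⟩, ⟨a ++ q ++ b, p', q', c⟩] ∨
      l' = [⟨a ++ p ++ b, p', q', c⟩, ⟨a, p, q, b ++ q' ++ c⟩]) := by
  induction h with
  | refl => rfl
  | symm _ _ _ ih => exact ih.symm
  | trans _ _ _ _ _ ih ih' => exact ih.trans ih'
  | rel l l' h =>
    obtain ⟨l₁, l₂, a₁, u, v, b₁, u', v', c₁⟩ := h
    have key : ∀ {k₁ k₂ k₃ k₄ : Step α}, l₁ ++ k₁ :: k₂ :: l₂ = [k₃, k₄] →
        l₁ = [] ∧ l₂ = [] ∧ k₁ = k₃ ∧ k₂ = k₄ := by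
      intro k₁ k₂ k₃ k₄ h
      have := congrArg List.length h
      simp only [List.length_append, List.length_cons, List.length_nil] at this
      obtain rfl := List.length_eq_zero_iff.1 (by omega : l₁.length = 0)
      obtain rfl := List.length_eq_zero_iff.1 (by omega : l₂.length = 0)
      simpa using h
    have hp₁ := List.length_pos_iff.2 hp
    have hp₂ := List.length_pos_iff.2 hp'
    constructor
    · rintro (h | h)
      · right
        obtain ⟨rfl, rfl, h₁, h₂⟩ := key h
        simp only [Step.mk.injEq] at h₁ h₂
        obtain ⟨rfl, rfl, rfl, -⟩ := h₁
        obtain ⟨h₂, rfl, rfl, rfl⟩ := h₂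
        obtain rfl := List.append_cancel_left h₂
        rfl
      · obtain ⟨rfl, rfl, h₁, h₂⟩ := key h
        simp only [Step.mk.injEq] at h₁ h₂
        have e₁ := congrArg List.length h₁.1
        have e₂ := congrArg List.length h₂.1
        simp only [List.length_append] at e₁ e₂
        omega
    · rintro (h | h)
      · obtain ⟨rfl, rfl, h₁, h₂⟩ := key h
        simp only [Step.mk.injEq] at h₁ h₂
        obtain ⟨h₃, rfl, rfl, -⟩ := h₁
        obtain ⟨h₄, rfl, rfl, -⟩ := h₂
        have e₁ := congrArg List.length h₃
        have e₂ := congrArg List.length h₄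
        simp only [List.length_append] at e₁ e₂
        omega
      · left
        obtain ⟨rfl, rfl, h₁, h₂⟩ := key h
        simp only [Step.mk.injEq] at h₁ h₂
        obtain ⟨h₁, rfl, rfl, rfl⟩ := h₁
        obtain ⟨rfl, rfl, rfl, h₂⟩ := h₂
        obtain rfl := List.append_cancel_left h₁
        rfl

theorem eq_of_isotopic_singleton {s s' : Step α} (h : Isotopic [s] [s']) : s = s' := by
  have key : ∀ {l l' : List (Step α)}, Isotopic l l' → l.length = 1 → l = l' := by
    intro l l' h
    induction h with
    | refl => exact fun _ => rfl
    | symm _ _ h ih => exact fun hl => (ih ((Isotopic.length_eq h).trans hl)).symm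
    | trans _ _ _ h _ ih ih' =>
      exact fun hl => (ih hl).trans (ih' ((Isotopic.length_eq h).symm.trans hl))
    | rel l l' h =>
      obtain ⟨l₁, l₂, a₁, u, v, b₁, u', v', c₁⟩ := h
      intro hl
      simp at hl
      omega
  simpa using key h rfl

theorem isSuffix_of_numCells_eq_zero {u v x : List α} {Δ : P.Diagram u x} (F : P.Diagram v x)
    (h : F.numCells = 0) : F.IsSuffix Δ := by
  obtain ⟨l, hl, hl', rfl⟩ := F.exists_mk
  obtain rfl := List.length_eq_zero_iff.1 (hl'.trans h)
  cases hl
  exact ⟨Δ, (comp_trivial Δ).symm⟩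

end Diagram

/-! ### Edges of the complex as gluings of cells -/

namespace FarleyVertex

theorem comp_eq_of_run {D E : P.FarleyVertex w} {l : List (Step α)}
    (hl : P.IsDerivation D.bot l E.bot) (h : run outs D.state l = E.state) :
    D.diagram.comp (Quot.mk _ ⟨l, hl⟩) = E.diagram :=
  Diagram.eq_of_botPath_eq ((Diagram.run_comp labels_outs _ _ _ _).trans h)

theorem isPrefix_of_fire {D E : P.FarleyVertex w} {c : List (PathEdge α) × List α}
    (h : P.Fire c D.state E.state) : D.diagram.IsPrefix E.diagram := by
  obtain ⟨s, hs, hr⟩ := h.exists_step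
  rw [labels_state, labels_state] at hs
  exact ⟨_, (comp_eq_of_run hs hr).symm⟩

theorem cells_subset_of_isPrefix {D E : P.FarleyVertex w}
    (h : D.diagram.IsPrefix E.diagram) : cells D.state ⊆ cells E.state := by
  obtain ⟨Γ, h⟩ := h
  have e : E.state = Γ.run labels_outs D.state D.labels_state := by
    unfold state
    rw [h]
    exact Diagram.run_comp labels_outs _ _ _ _
  rw [e]
  obtain ⟨l, hl, -, rfl⟩ := Γ.exists_mk
  exact cells_subset_run hl D.labels_state

/-- The two alternatives are those of `toggle`: the atomic factor adds its cell, or it cancels an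
exposed cell of `D`. -/
theorem fire_of_isProduct {D E : P.FarleyVertex w} {x : List α} {A : P.Diagram D.bot x}
    (hA : A.IsAtomic) (h : D.IsProduct A E) :
    ∃ c, P.Fire c D.state E.state ∨ P.Fire c E.state D.state := by
  obtain ⟨s, hs, rfl⟩ := hA.exists_mk
  have h' : E.state = act toggle D.state s := h.state_eq
  obtain ⟨hc, ht, -⟩ := hs
  obtain ⟨x, m, y, hD, hx, hm, hy⟩ := exists_split (D.labels_state.trans ht.symm)
  rw [hD, act_eq hx hm] at h'
  rw [← hm] at hc
  rcases toggle_cases hc.ne_nil.1 s.tgt with ⟨h'', -⟩ | h''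
  · rw [h''] at h'
    exact ⟨(m, s.tgt), Or.inl ⟨hc, x, y, hD, h'⟩⟩
  · refine ⟨(toggle m s.tgt, labels m), Or.inr ⟨?_, x, y, h', ?_⟩⟩
    · rw [labels_toggle]; exact hc.symm
    · rw [hD]; dsimp only; rw [← h'']

theorem ne_of_fire {D E : P.FarleyVertex w} {c : List (PathEdge α) × List α}
    (h : P.Fire c D.state E.state) : D ≠ E := by
  rintro rfl
  obtain ⟨n, hn⟩ := D.exists_reach
  refine h.notMem_cells hn ?_
  rw [h.cells_eq]
  exact Set.mem_insert _ _

theorem adj_of_fire {D E : P.FarleyVertex w} {c : List (PathEdge α) × List α}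
    (h : P.Fire c D.state E.state) : (farleyGraph P w).Adj D E := by
  obtain ⟨s, hs, hr⟩ := h.exists_step
  rw [labels_state] at hs
  exact (SimpleGraph.fromRel_adj _ _ _).2
    ⟨ne_of_fire h, Or.inl ⟨_, Quot.mk _ ⟨[s], hs⟩, rfl, isProduct_of_run hs hr⟩⟩

theorem adj_iff {D E : P.FarleyVertex w} : (farleyGraph P w).Adj D E ↔
    ∃ c, P.Fire c D.state E.state ∨ P.Fire c E.state D.state := by
  constructor
  · intro h
    rcases ((SimpleGraph.fromRel_adj _ _ _).1 h).2 with ⟨x, A, hA, h⟩ | ⟨x, A, hA, h⟩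
    · exact fire_of_isProduct hA h
    · exact (fire_of_isProduct hA h).imp fun _ => Or.symm
  · rintro ⟨c, h | h⟩
    · exact adj_of_fire h
    · exact (adj_of_fire h).symm

/-- The vertex obtained by removing a cell that can be removed. -/
theorem exists_fire {E : P.FarleyVertex w} {n : ℕ} {c : List (PathEdge α) × List α}
    {x y : List (PathEdge α)} (hE : P.Reach w n E.state) (hc : c.2 ≠ [])
    (h : E.state = x ++ outs c.1 c.2 ++ y) :
    ∃ (D : P.FarleyVertex w) (m : ℕ), n = m + 1 ∧ P.Reach w m D.state ∧
      D.state = x ++ c.1 ++ y ∧ P.Fire c D.state E.state := by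
  obtain ⟨m, hm, hr, hF⟩ := hE.unfire hc h
  obtain ⟨D, hD⟩ := exists_state_eq hr (hF.good E.good_state)
  exact ⟨D, m, hm, hD ▸ hr, hD, hD ▸ hF⟩

end FarleyVertex

theorem Diagram.exists_isReducedForm {u v : List α} (Δ : P.Diagram u v) :
    ∃ R, Δ.IsReducedForm R := by
  induction hn : Δ.numCells using Nat.strong_induction_on generalizing Δ with | _ n ih =>
  by_cases h : Δ.IsReduced
  · exact ⟨Δ, h, .refl⟩
  · unfold Diagram.IsReduced at h
    push Not at h
    obtain ⟨Δ', h⟩ := h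
    have hlt : Δ'.numCells < n := by
      obtain ⟨p, a, b, q, hc, A, B, rfl, rfl⟩ := h
      have e : (Diagram.cell p q hc).numCells = 1 := rfl
      simp only [Diagram.numCells_comp] at hn ⊢
      omega
    obtain ⟨R, hR, hR'⟩ := ih _ hlt Δ' rfl
    exact ⟨R, hR, .head h hR'⟩

/-! ### Minimal diagrams are the diagrams with a tip -/

namespace FarleyVertex

theorem exists_isProduct (D : P.FarleyVertex w) {x : List α} (Γ : P.Diagram D.bot x) :
    ∃ E, D.IsProduct Γ E := by
  obtain ⟨R, hR⟩ := (D.diagram.comp Γ).exists_isReducedForm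
  exact ⟨⟨x, R, hR.1⟩, R, hR, rfl⟩

theorem exists_state_eq_of_suffix {D : P.FarleyVertex w} {u : List α} {G : P.Diagram w u}
    {l : List (Step α)} {s : Step α} {h : P.IsDerivation u (l ++ [s]) D.bot}
    (hD : D.diagram = G.comp (Quot.mk _ ⟨_, h⟩)) :
    ∃ x t y, D.state = x ++ outs t s.tgt ++ y ∧ s = ⟨labels x, labels t, s.tgt, labels y⟩ ∧
      s.tgt ≠ [] := by
  obtain ⟨k, hk, -, rfl⟩ := G.exists_mk
  obtain ⟨m, h₁, h₂, h₃, -⟩ := h.of_append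
  have h₄ := hk.append h₁
  obtain ⟨x, t, y, -, hS, hs, -⟩ := exists_fire_of_step h₂
    ((labels_run labels_outs h₄ (labels_initPath w)).trans h₃.symm)
  refine ⟨x, t, y, ?_, hs, h₂.ne_nil.2⟩
  rw [← hS]
  unfold state
  rw [hD]
  change run outs (initPath w) (k ++ (l ++ [s])) = _
  rw [← List.append_assoc, run_append (l := k ++ l)]
  rfl

theorem exists_comp_eq {D E : P.FarleyVertex w} {c : List (PathEdge α) × List α}
    {x y : List (PathEdge α)} (hc : P.IsCell (labels c.1) c.2) (hD : D.state = x ++ c.1 ++ y)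
    (hE : E.state = x ++ outs c.1 c.2 ++ y) :
    ∃ h : P.IsDerivation D.bot [⟨labels x, labels c.1, c.2, labels y⟩] E.bot,
      E.diagram = D.diagram.comp (Quot.mk _ ⟨_, h⟩) := by
  have h : P.IsDerivation D.bot [⟨labels x, labels c.1, c.2, labels y⟩] E.bot := by
    rw [← D.labels_state, ← E.labels_state, hD, hE]
    exact ⟨hc, by simp [Step.top], by simp [Step.bot, IsDerivation]⟩
  refine ⟨h, (comp_eq_of_run h ?_).symm⟩
  rw [hD, hE]
  exact act_eq rfl rfl

/-- The last step of any suffix glues a removable cell, hence `c`, at the unique place where it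
occurs. A thin suffix with two cells would allow last steps at two different places. -/
theorem isMinimal_of_isTip {D : P.FarleyVertex w} {c : List (PathEdge α) × List α}
    (h : IsTip c D.state) : D.diagram.IsMinimal := by
  obtain ⟨n, hn⟩ := D.exists_reach
  obtain ⟨hc, x, y, hD⟩ := h.exists_eq hn
  have hnd := hn.nodup
  obtain ⟨D₀, m, -, -, hD₀, hF⟩ := exists_fire hn hc hD
  obtain ⟨hd, hcomp⟩ := exists_comp_eq hF.1 hD₀ hD
  have hpos : ∀ {x' y' t' v'}, v' ≠ [] → D.state = x' ++ outs t' v' ++ y' →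
      t' = c.1 ∧ v' = c.2 ∧ x' = x ∧ y' = y := by
    intro x' y' t' v' hv' h'
    have := h.2 (t', v') x' y' hv' h'
    subst this
    rw [hD] at h' hnd
    obtain ⟨rfl, rfl⟩ := append_inj_of_nodup (outs_ne_nil hc) hnd h'
    exact ⟨rfl, rfl, rfl, rfl⟩
  refine ⟨_, Quot.mk _ ⟨_, hd⟩, ⟨Diagram.isThin_singleton hd, ⟨_, hcomp⟩, ?_⟩, rfl⟩
  rintro v' F' hF' ⟨G, hG⟩
  rcases Nat.lt_or_ge F'.numCells 2 with h2 | h2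
  · rcases Nat.lt_or_ge F'.numCells 1 with h1 | h1
    · exact Diagram.isSuffix_of_numCells_eq_zero F' (by omega)
    · obtain ⟨s, hs, rfl⟩ := Diagram.IsAtomic.exists_mk (Δ := F') (by
        unfold Diagram.IsAtomic; omega)
      obtain ⟨x', t', y', h₁, h₂, h₃⟩ := exists_state_eq_of_suffix (l := []) (s := s) (h := hs) hG
      obtain ⟨rfl, h₄, rfl, rfl⟩ := hpos h₃ h₁
      rw [h₄] at h₂
      subst h₂
      obtain rfl : D₀.bot = v' := hd.2.1.symm.trans hs.2.1
      exact ⟨Diagram.trivial P _, (Diagram.trivial_comp _).symm⟩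
  · obtain ⟨l₁, l₂, s₁, s₂, h₁, h₂, rfl, e₂, hlt⟩ := hF'.exists_two h2
    obtain ⟨x₁, t₁, y₁, h₃, h₄, h₅⟩ := exists_state_eq_of_suffix hG
    rw [e₂] at hG
    obtain ⟨x₂, t₂, y₂, h₆, h₇, h₈⟩ := exists_state_eq_of_suffix hG
    obtain ⟨-, -, rfl, -⟩ := hpos h₅ h₃
    obtain ⟨-, -, rfl, -⟩ := hpos h₈ h₆
    rw [h₄, h₇] at hlt
    exact absurd hlt (lt_irrefl _)

/-- Each removable cell is by itself a thin suffix, hence a suffix of the one-cell diagram `F`,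
hence equal to it. Multiplying by `F.inv` then removes this cell. -/
theorem exists_isTip {D : P.FarleyVertex w} {v : List α} {F : P.Diagram v D.bot}
    (hF : F.IsMaximalThinSuffix D.diagram) (h1 : F.numCells = 1) :
    ∃ c, IsTip c D.state ∧ ∀ E : P.FarleyVertex w, D.IsProduct F.inv E →
      P.Fire c E.state D.state := by
  obtain ⟨n, hn⟩ := D.exists_reach
  obtain ⟨-, ⟨G, hG⟩, hmax⟩ := hF
  obtain ⟨s, hs, rfl⟩ := Diagram.IsAtomic.exists_mk (Δ := F) h1
  obtain ⟨x, t, y, hD, hs', hv⟩ := exists_state_eq_of_suffix (l := []) (s := s) (h := hs) hG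
  have hc := hs.1
  generalize s.tgt = q at hD hs' hv hc
  subst hs'
  dsimp only at hc
  refine ⟨(t, q), ⟨?_, ?_⟩, ?_⟩
  · rw [hD]
    simp only [cells_append, cells_outs _ hv]
    exact Or.inl (Or.inr (Or.inl rfl))
  · intro d x' y' hd hD'
    obtain ⟨D₀, m, -, -, hD₀, hF⟩ := exists_fire hn hd hD'
    obtain ⟨hd', hcomp⟩ := exists_comp_eq hF.1 hD₀ hD'
    obtain ⟨Δ, hΔ⟩ := hmax _ (Quot.mk _ ⟨_, hd'⟩) (Diagram.isThin_singleton hd') ⟨_, hcomp⟩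
    obtain ⟨l, hl, -, rfl⟩ := Δ.exists_mk
    have hi := Diagram.mk_eq_mk.1 hΔ
    have hlen := Isotopic.length_eq hi
    simp only [List.length_append, List.length_cons, List.length_nil] at hlen
    obtain rfl := List.length_eq_zero_iff.1 (by omega : l.length = 0)
    have e := Diagram.eq_of_isotopic_singleton hi
    -- Steps record labels only; equal positions inside the same path then force equal segments, and
    -- with them equal histories.
    simp only [Step.mk.injEq] at e
    obtain ⟨e₁, -, rfl, -⟩ := e
    rw [hD, List.append_assoc, List.append_assoc] at hD'
    have hx : x.length = x'.length := by rw [← length_labels, e₁, length_labels]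
    have h₁ := (List.append_inj hD' hx).2
    have hlen' : (outs t d.2).length = (outs d.1 d.2).length := by
      rw [← length_labels, labels_outs, ← length_labels, labels_outs]
    rw [outs_inj_left hv (List.append_inj h₁ hlen').1]
  · intro E hE
    have h' : E.state = act toggle D.state ⟨labels x, q, labels t, labels y⟩ := hE.state_eq
    rw [hD, act_eq (m := outs t q) rfl (labels_outs t q)] at h'
    dsimp only at h'
    rw [toggle_outs t hv] at h'
    exact ⟨hc, x, y, h', hD⟩

end FarleyVertex

/-! ### Squares and the cells glued along their sides -/

/-- The cell `c` is glued when the edge `e` is crossed. -/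
def EdgeCell (e : Sym2 (P.FarleyVertex w)) (c : List (PathEdge α) × List α) : Prop :=
  ∃ D E : P.FarleyVertex w, e = s(D, E) ∧ P.Fire c D.state E.state

theorem EdgeCell.unique {e : Sym2 (P.FarleyVertex w)} {c d : List (PathEdge α) × List α}
    (hc : EdgeCell e c) (hd : EdgeCell e d) : c = d := by
  obtain ⟨D, E, rfl, h⟩ := hc
  obtain ⟨D', E', he, h'⟩ := hd
  obtain ⟨n, hn⟩ := D.exists_reach
  obtain ⟨n', hn'⟩ := D'.exists_reach
  have h₁ := h.notMem_cells hn
  have h₂ : c ∈ cells E.state := by rw [h.cells_eq]; exact Set.mem_insert _ _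
  rcases Sym2.eq_iff.1 he with ⟨rfl, rfl⟩ | ⟨rfl, rfl⟩
  · rw [h'.cells_eq] at h₂
    exact h₂.resolve_right h₁
  · refine absurd ?_ h₁
    rw [h'.cells_eq]
    exact Or.inr h₂

theorem exists_edgeCell {e : Sym2 (P.FarleyVertex w)} (he : e ∈ (farleyGraph P w).edgeSet) :
    ∃ c, EdgeCell e c := by
  induction e using Sym2.ind with | _ D E =>
  obtain ⟨c, h | h⟩ := FarleyVertex.adj_iff.1 he
  · exact ⟨c, D, E, rfl, h⟩
  · exact ⟨c, E, D, Sym2.eq_swap, h⟩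

/-- The base vertex of a cube may be any of its corners; this selects the cell so that the smaller
of the two paths is the one without it. -/
theorem exists_toggle_pair {m : List (PathEdge α)} {q : List α} (h : P.IsCell (labels m) q) :
    ∃ c : List (PathEdge α) × List α, P.IsCell (labels c.1) c.2 ∧
      ∀ p, p = m ∨ p = toggle m q → ∃ i : Bool, p = cond i (outs c.1 c.2) c.1 := by
  rcases toggle_cases h.ne_nil.1 q with ⟨h', -⟩ | h'
  · refine ⟨(m, q), h, ?_⟩
    rintro p (rfl | rfl)
    · exact ⟨false, rfl⟩
    · exact ⟨true, h'⟩
  · refine ⟨(toggle m q, labels m), by simpa using h.symm, ?_⟩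
    rintro p (rfl | rfl)
    · exact ⟨true, h'⟩
    · exact ⟨false, rfl⟩

/-- The bottom paths of the vertices of a square. -/
def squarePath (x z y : List (PathEdge α)) (c₁ c₂ : List (PathEdge α) × List α) (i j : Bool) :
    List (PathEdge α) :=
  x ++ cond i (outs c₁.1 c₁.2) c₁.1 ++ z ++ cond j (outs c₂.1 c₂.2) c₂.1 ++ y

theorem IsCube.exists_squarePath {S : Set (P.FarleyVertex w)} (h : IsCube 2 S) :
    ∃ x z y c₁ c₂, P.IsCell (labels c₁.1) c₁.2 ∧ P.IsCell (labels c₂.1) c₂.2 ∧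
      ∀ E ∈ S, ∃ i j, E.state = squarePath x z y c₁ c₂ i j := by
  obtain ⟨D, v, Γ, hΓ, hn, rfl⟩ := h
  obtain ⟨a, p, q, b, p', q', c, hd, rfl⟩ := hΓ.exists_pair hn
  obtain ⟨h₁, h₂, h₃, h₄, h₅⟩ := id hd
  obtain ⟨x, m₁, r, hD, hx, hm₁, hr⟩ := exists_split (D.labels_state.trans h₂.symm)
  obtain ⟨z, m₂, y, rfl, hz, hm₂, hy⟩ := exists_split hr
  dsimp only at *
  have hc₁ := h₁
  have hc₂ := h₃
  rw [← hm₁] at hc₁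
  rw [← hm₂] at hc₂
  obtain ⟨c₁, hc₁', hp₁⟩ := exists_toggle_pair hc₁
  obtain ⟨c₂, hc₂', hp₂⟩ := exists_toggle_pair hc₂
  refine ⟨x, z, y, c₁, c₂, hc₁', hc₂', ?_⟩
  rintro E ⟨b', Q, ⟨Q', hQ⟩, hE⟩
  have hst := hE.state_eq
  suffices ∃ p₁ p₂, (p₁ = m₁ ∨ p₁ = toggle m₁ q) ∧ (p₂ = m₂ ∨ p₂ = toggle m₂ q') ∧
      E.state = x ++ p₁ ++ z ++ p₂ ++ y by
    obtain ⟨p₁, p₂, e₁, e₂, e⟩ := this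
    obtain ⟨i, rfl⟩ := hp₁ p₁ e₁
    obtain ⟨j, rfl⟩ := hp₂ p₂ e₂
    exact ⟨i, j, e⟩
  obtain ⟨l, hl, -, rfl⟩ := Q.exists_mk
  obtain ⟨l', hl', -, rfl⟩ := Q'.exists_mk
  have hi : Isotopic _ (l ++ l') := Diagram.mk_eq_mk.1 hQ
  have hl'' := (Diagram.isotopic_pair_iff h₁.ne_nil.1 h₃.ne_nil.1 hi).1 (Or.inl rfl)
  change E.state = run toggle D.state l at hst
  have hD' : D.state = (x ++ m₁ ++ z) ++ m₂ ++ y := by rw [hD]; simp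
  have a₁ : ∀ r' r'', act toggle (x ++ m₁ ++ r') ⟨a, p, q, r''⟩ = x ++ toggle m₁ q ++ r' :=
    fun _ _ => act_eq hx hm₁
  have a₂ : act toggle ((x ++ toggle m₁ q ++ z) ++ m₂ ++ y) ⟨a ++ q ++ b, p', q', c⟩ =
      (x ++ toggle m₁ q ++ z) ++ toggle m₂ q' ++ y := act_eq (by simp [hx, hz]) hm₂
  have a₃ : act toggle ((x ++ m₁ ++ z) ++ m₂ ++ y) ⟨a ++ p ++ b, p', q', c⟩ =
      (x ++ m₁ ++ z) ++ toggle m₂ q' ++ y := act_eq (by simp [hx, hz, hm₁]) hm₂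
  have b₁ : act toggle D.state ⟨a, p, q, b ++ p' ++ c⟩ = (x ++ toggle m₁ q ++ z) ++ m₂ ++ y := by
    rw [hD, a₁]; simp
  have b₂ : act toggle D.state ⟨a ++ p ++ b, p', q', c⟩ = (x ++ m₁ ++ z) ++ toggle m₂ q' ++ y := by
    rw [hD', a₃]
  have b₃ : act toggle ((x ++ m₁ ++ z) ++ toggle m₂ q' ++ y) ⟨a, p, q, b ++ q' ++ c⟩ =
      (x ++ toggle m₁ q ++ z) ++ toggle m₂ q' ++ y := by
    have e : (x ++ m₁ ++ z) ++ toggle m₂ q' ++ y = x ++ m₁ ++ (z ++ toggle m₂ q' ++ y) := by simp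
    rw [e, a₁]; simp
  have key : ∀ {k₁ k₂ : Step α}, l ++ l' = [k₁, k₂] → l = [] ∨ l = [k₁] ∨ l = [k₁, k₂] := by
    intro k₁ k₂ h
    match l, h with
    | [], _ => exact Or.inl rfl
    | [k], h => simp at h; simp [h.1]
    | [k, k'], h => simp at h; simp [h.1, h.2.1]
    | k :: k' :: k'' :: l, h => simp at h
  rcases hl'' with hl'' | hl'' <;> rcases key hl'' with rfl | rfl | rfl
  · exact ⟨m₁, m₂, Or.inl rfl, Or.inl rfl, hst.trans hD'⟩
  · exact ⟨_, m₂, Or.inr rfl, Or.inl rfl, hst.trans b₁⟩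
  · refine ⟨_, _, Or.inr rfl, Or.inr rfl, hst.trans ?_⟩
    rw [run_cons, b₁, run_cons, a₂, run_nil]
  · exact ⟨m₁, m₂, Or.inl rfl, Or.inl rfl, hst.trans hD'⟩
  · exact ⟨m₁, _, Or.inl rfl, Or.inr rfl, hst.trans b₂⟩
  · refine ⟨_, _, Or.inr rfl, Or.inr rfl, hst.trans ?_⟩
    rw [run_cons, b₂, run_cons, b₃, run_nil]

section Square

variable {x z y : List (PathEdge α)} {c₁ c₂ : List (PathEdge α) × List α}

theorem fire_squarePath_left (h₁ : P.IsCell (labels c₁.1) c₁.2) (j : Bool) :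
    P.Fire c₁ (squarePath x z y c₁ c₂ false j) (squarePath x z y c₁ c₂ true j) :=
  ⟨h₁, x, z ++ cond j (outs c₂.1 c₂.2) c₂.1 ++ y, by simp [squarePath], by simp [squarePath]⟩

theorem fire_squarePath_right (h₂ : P.IsCell (labels c₂.1) c₂.2) (i : Bool) :
    P.Fire c₂ (squarePath x z y c₁ c₂ i false) (squarePath x z y c₁ c₂ i true) :=
  ⟨h₂, x ++ cond i (outs c₁.1 c₁.2) c₁.1 ++ z, y, by simp [squarePath], by simp [squarePath]⟩

theorem reach_of_fire {c : List (PathEdge α) × List α} {n : ℕ} {S S' : List (PathEdge α)}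
    (h : P.Fire c S S') (hS' : P.Reach w n S') : ∃ m, P.Reach w m S := by
  obtain ⟨hc, x, y, rfl, hS⟩ := h
  obtain ⟨m, -, h, -⟩ := hS'.unfire hc.ne_nil.2 hS
  exact ⟨m, h⟩

/-- Membership of `c₁` and `c₂` in the set of cells reads off the corner, so one more cell means
that exactly one coordinate changes. -/
theorem eq_of_fire_squarePath (h₁ : P.IsCell (labels c₁.1) c₁.2)
    (h₂ : P.IsCell (labels c₂.1) c₂.2) {c : List (PathEdge α) × List α} {i j i' j' : Bool}
    {n : ℕ} (hn : P.Reach w n (squarePath x z y c₁ c₂ i j))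
    (h : P.Fire c (squarePath x z y c₁ c₂ i j) (squarePath x z y c₁ c₂ i' j')) :
    (c = c₁ ∧ i = false ∧ i' = true ∧ j = j') ∨ (c = c₂ ∧ j = false ∧ j' = true ∧ i = i') := by
  obtain ⟨m, hm⟩ : ∃ m, P.Reach w m (squarePath x z y c₁ c₂ false false) := by
    have h₃ : ∃ m, P.Reach w m (squarePath x z y c₁ c₂ false j) := by
      cases i with
      | false => exact ⟨n, hn⟩
      | true => exact reach_of_fire (fire_squarePath_left h₁ j) hn
    cases j with
    | false => exact h₃
    | true => exact reach_of_fire (fire_squarePath_right h₂ false) h₃.choose_spec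
  have f₁ := fire_squarePath_left (x := x) (z := z) (y := y) (c₂ := c₂) h₁ false
  have f₂ := fire_squarePath_right (x := x) (z := z) (y := y) (c₁ := c₁) h₂ false
  have f₃ := fire_squarePath_right (x := x) (z := z) (y := y) (c₁ := c₁) h₂ true
  have n₁ := f₁.notMem_cells hm
  have n₂ := f₂.notMem_cells hm
  have n₃ := f₃.notMem_cells (n := m + 1) (w := w) ⟨_, _, hm, f₁⟩
  have hcells : ∀ i j c, c ∈ cells (squarePath x z y c₁ c₂ i j) ↔
      c ∈ cells (squarePath x z y c₁ c₂ false false) ∨ (i = true ∧ c = c₁) ∨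
        (j = true ∧ c = c₂) := by
    intro i j c
    cases i <;> cases j
    · simp
    · rw [f₂.cells_eq, Set.mem_insert_iff]; simp; tauto
    · rw [f₁.cells_eq, Set.mem_insert_iff]; simp; tauto
    · rw [f₃.cells_eq, f₁.cells_eq, Set.mem_insert_iff, Set.mem_insert_iff]; simp; tauto
  have hne : c₁ ≠ c₂ := by
    -- Equal cells would be glued twice on the way from the lowest to the highest corner.
    rintro rfl
    exact n₃ ((hcells _ _ _).2 (Or.inr (Or.inl ⟨rfl, rfl⟩)))
  have hc := h.notMem_cells hn
  have hc' : ∀ d, d ∈ cells (squarePath x z y c₁ c₂ i' j') ↔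
      d = c ∨ d ∈ cells (squarePath x z y c₁ c₂ i j) := by
    intro d; rw [h.cells_eq]; rfl
  have m₁ : ∀ i j, c₁ ∈ cells (squarePath x z y c₁ c₂ i j) ↔ i = true := by
    intro i j
    rw [hcells]
    simp [n₁, hne]
  have m₂ : ∀ i j, c₂ ∈ cells (squarePath x z y c₁ c₂ i j) ↔ j = true := by
    intro i j
    rw [hcells]
    simp [n₂, hne.symm]
  have g := (hc' c).2 (Or.inl rfl)
  have g₁ := hc' c₁
  have g₂ := hc' c₂
  rw [m₁, m₁] at g₁
  rw [m₂, m₂] at g₂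
  by_cases e₁ : c = c₁
  · subst e₁
    rw [m₁] at hc g
    exact Or.inl ⟨rfl, by simpa using hc, g,
      Bool.eq_iff_iff.2 (g₂.trans (or_iff_right hne.symm)).symm⟩
  · by_cases e₂ : c = c₂
    · subst e₂
      rw [m₂] at hc g
      exact Or.inr ⟨rfl, by simpa using hc, g,
        Bool.eq_iff_iff.2 (g₁.trans (or_iff_right hne)).symm⟩
    · rw [hcells] at hc g
      tauto

end Square

/-- Sides of a square that glue different cells change different coordinates, and such sides share a
corner. -/
theorem AreParallelSides.edgeCell_eq {e f : (farleyGraph P w).edgeSet}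
    (h : AreParallelSides e f) {c d : List (PathEdge α) × List α} (hc : EdgeCell e.1 c)
    (hd : EdgeCell f.1 d) : c = d := by
  obtain ⟨S, hS, he, hf, hef⟩ := h
  obtain ⟨x, z, y, c₁, c₂, h₁, h₂, hsq⟩ := hS.exists_squarePath
  obtain ⟨D, E, h₃, hF⟩ := hc
  obtain ⟨D', E', h₄, hF'⟩ := hd
  rw [h₃] at he hef
  rw [h₄] at hf hef
  obtain ⟨n, hn⟩ := D.exists_reach
  obtain ⟨n', hn'⟩ := D'.exists_reach
  obtain ⟨i, j, hD⟩ := hsq D (he D (by simp))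
  obtain ⟨i', j', hE⟩ := hsq E (he E (by simp))
  obtain ⟨k, l, hD'⟩ := hsq D' (hf D' (by simp))
  obtain ⟨k', l', hE'⟩ := hsq E' (hf E' (by simp))
  have hne : ∀ A ∈ s(D, E), ∀ B ∈ s(D', E'), A.state ≠ B.state := by
    intro A hA B hB hAB
    obtain rfl := FarleyVertex.state_injective hAB
    exact hef A hA hB
  have n₁ := hne D (by simp) D' (by simp)
  have n₂ := hne D (by simp) E' (by simp)
  have n₃ := hne E (by simp) D' (by simp)
  have n₄ := hne E (by simp) E' (by simp)
  rw [hD, hE] at hF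
  rw [hD', hE'] at hF'
  rw [hD] at hn n₁ n₂
  rw [hE] at n₃ n₄
  rw [hD'] at hn' n₁ n₃
  rw [hE'] at n₂ n₄
  rcases eq_of_fire_squarePath h₁ h₂ hn hF with ⟨rfl, rfl, rfl, rfl⟩ | ⟨rfl, rfl, rfl, rfl⟩ <;>
  rcases eq_of_fire_squarePath h₁ h₂ hn' hF' with ⟨rfl, rfl, rfl, rfl⟩ | ⟨rfl, rfl, rfl, rfl⟩
  · rfl
  · cases j <;> cases k <;> exact absurd rfl ‹_›
  · cases i <;> cases l <;> exact absurd rfl ‹_›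
  · rfl

theorem fire_mem_edgeSet {D E : P.FarleyVertex w} {c : List (PathEdge α) × List α}
    (h : P.Fire c D.state E.state) : s(D, E) ∈ (farleyGraph P w).edgeSet :=
  FarleyVertex.adj_of_fire h

/-- All four corners are reduced vertices, so gluing without cancellation already computes the
products with the prefixes. -/
theorem isCube_of_squarePath {x z y : List (PathEdge α)} {c₁ c₂ : List (PathEdge α) × List α}
    (h₁ : P.IsCell (labels c₁.1) c₁.2) (h₂ : P.IsCell (labels c₂.1) c₂.2)
    {D : Bool → Bool → P.FarleyVertex w}
    (hD : ∀ i j, (D i j).state = squarePath x z y c₁ c₂ i j) :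
    ∃ S : Set (P.FarleyVertex w), IsCube 2 S ∧ ∀ i j, D i j ∈ S := by
  have hD₀ := hD false false
  have hbot : (D false false).bot = labels (squarePath x z y c₁ c₂ false false) := by
    rw [← hD₀, FarleyVertex.labels_state]
  have d : P.IsDerivation (D false false).bot
      [⟨labels x, labels c₁.1, c₁.2, labels z ++ labels c₂.1 ++ labels y⟩,
        ⟨labels x ++ c₁.2 ++ labels z, labels c₂.1, c₂.2, labels y⟩]
      (labels (squarePath x z y c₁ c₂ true true)) := by
    rw [hbot]
    exact ⟨h₁, by simp [Step.top, squarePath], h₂, by simp [Step.top, Step.bot],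
      by simp [Step.bot, squarePath, IsDerivation]⟩
  refine ⟨_, ⟨D false false, _, Quot.mk _ ⟨_, d⟩, Diagram.isThin_pair d, rfl, rfl⟩, ?_⟩
  have key : ∀ (E : P.FarleyVertex w) (l l' : List (Step α)),
      Isotopic [⟨labels x, labels c₁.1, c₁.2, labels z ++ labels c₂.1 ++ labels y⟩,
        ⟨labels x ++ c₁.2 ++ labels z, labels c₂.1, c₂.2, labels y⟩] (l ++ l') →
      run outs (D false false).state l = E.state →
      ∃ (b : List α) (Q : P.Diagram (D false false).bot b),
        Q.IsPrefix (Quot.mk _ ⟨_, d⟩ : P.Diagram _ _) ∧ (D false false).IsProduct Q E := by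
    intro E l l' hi hr
    obtain ⟨m, hl, hl'⟩ := ((Isotopic.isDerivation_iff hi).1 d).of_append
    exact ⟨m, Quot.mk _ ⟨l, hl⟩, ⟨Quot.mk _ ⟨l', hl'⟩, Diagram.mk_eq_mk.2 hi⟩,
      FarleyVertex.isProduct_of_run hl hr⟩
  have e₁ : act outs (squarePath x z y c₁ c₂ false false)
      ⟨labels x, labels c₁.1, c₁.2, labels z ++ labels c₂.1 ++ labels y⟩ =
      squarePath x z y c₁ c₂ true false := by
    have e : squarePath x z y c₁ c₂ false false = x ++ c₁.1 ++ (z ++ c₂.1 ++ y) := by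
      simp [squarePath]
    rw [e, act_eq rfl rfl]
    simp [squarePath]
  intro i j
  cases i <;> cases j
  · exact key _ [] _ (.refl _) rfl
  · refine key _ [⟨labels x ++ labels c₁.1 ++ labels z, labels c₂.1, c₂.2, labels y⟩]
      [⟨labels x, labels c₁.1, c₁.2, labels z ++ c₂.2 ++ labels y⟩]
      (.rel _ _ (Exchange.mk [] [] _ _ _ _ _ _ _)) ?_
    rw [hD, hD, run_cons, run_nil]
    exact act_eq (by simp) rfl
  · refine key _ [_] [_] (.refl _) ?_
    rw [hD, hD, run_cons, run_nil, e₁]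
  · refine key _ _ [] (by rw [List.append_nil]; exact .refl _) ?_
    rw [hD, hD, run_cons, run_cons, run_nil, e₁]
    exact act_eq (by simp) rfl

theorem areParallelSides_of_fire {A B C D : P.FarleyVertex w} {S : Set (P.FarleyVertex w)}
    {c d : List (PathEdge α) × List α} (hS : IsCube 2 S) (hA : A ∈ S) (hB : B ∈ S) (hC : C ∈ S)
    (hD : D ∈ S) (hAB : P.Fire c A.state B.state) (hCD : P.Fire c C.state D.state)
    (hAC : P.Fire d A.state C.state) (hBD : P.Fire d B.state D.state) :
    AreParallelSides ⟨s(A, B), fire_mem_edgeSet hAB⟩ ⟨s(C, D), fire_mem_edgeSet hCD⟩ := by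
  obtain ⟨n, hn⟩ := A.exists_reach
  obtain ⟨m, hm⟩ := B.exists_reach
  have h₁ := hAC.notMem_cells hn
  have h₂ := hBD.notMem_cells hm
  have h₃ : d ∈ cells C.state := by rw [hAC.cells_eq]; exact Set.mem_insert _ _
  have h₄ : d ∈ cells D.state := by rw [hBD.cells_eq]; exact Set.mem_insert _ _
  refine ⟨S, hS, ?_, ?_, ?_⟩
  · intro X hX
    rcases Sym2.mem_iff.1 hX with rfl | rfl <;> assumption
  · intro X hX
    rcases Sym2.mem_iff.1 hX with rfl | rfl <;> assumption
  · intro X hX hX'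
    have h₅ : d ∉ cells X.state := by rcases Sym2.mem_iff.1 hX with rfl | rfl <;> assumption
    refine h₅ ?_
    rcases Sym2.mem_iff.1 hX' with rfl | rfl <;> assumption

/-! ### Transport of edges along squares -/

/-- An edge is parallel to the corresponding edge after a removable cell has been removed. -/
theorem exists_parallel_of_fire {D E : P.FarleyVertex w} {n : ℕ}
    {c d : List (PathEdge α) × List α} (h : P.Fire c D.state E.state)
    (hE : P.Reach w (n + 1) E.state) (hd : d.2 ≠ []) (hcd : d ≠ c) {x y : List (PathEdge α)}
    (hx : E.state = x ++ outs d.1 d.2 ++ y) :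
    ∃ (D' E' : P.FarleyVertex w) (h' : P.Fire c D'.state E'.state), P.Reach w n E'.state ∧
      AreParallelSides ⟨s(D', E'), fire_mem_edgeSet h'⟩ ⟨s(D, E), fire_mem_edgeSet h⟩ := by
  obtain ⟨hc, x', y', hD', hE'⟩ := id h
  obtain ⟨m, hm⟩ := D.exists_reach
  obtain ⟨E₀, n', hn', hr, hE₀, hF⟩ := FarleyVertex.exists_fire hE hd hx
  obtain rfl : n = n' := by omega
  have hne := hc.ne_nil.2
  rcases segment_trichotomy (outs_ne_nil hne) (outs_ne_nil hd) (hE'.symm.trans hx) with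
    ⟨e, he, he'⟩ | ⟨z, rfl, rfl⟩ | ⟨z, rfl, rfl⟩
  · obtain ⟨h₁, h₂⟩ := eq_of_mem_outs he he'
    exact absurd (Prod.ext h₁ h₂).symm hcd
  · obtain ⟨D₀, m', -, -, hD₀, -⟩ := FarleyVertex.exists_fire (c := d)
      (x := x' ++ c.1 ++ z) (y := y) hm hd (by rw [hD']; simp)
    -- The first index records whether `c` is glued, the second whether `d` is; when `d` lies to the
    -- left of `c`, the roles are interchanged.
    let V : Bool → Bool → P.FarleyVertex w := fun i j => cond i (cond j E E₀) (cond j D D₀)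
    have hV : ∀ i j, (V i j).state = squarePath x' z y c d i j := by
      intro i j
      cases i <;> cases j
      · exact hD₀
      · exact hD'.trans (by simp [squarePath])
      · exact hE₀
      · exact hE'.trans (by simp [squarePath])
    obtain ⟨S, hS, hVS⟩ := isCube_of_squarePath hc hF.1 hV
    have f₁ : P.Fire c D₀.state E₀.state := by
      have := fire_squarePath_left (x := x') (z := z) (y := y) (c₂ := d) hc false
      rwa [← hV, ← hV] at this
    have f₂ : P.Fire d D₀.state D.state := by
      have := fire_squarePath_right (x := x') (z := z) (y := y) (c₁ := c) hF.1 false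
      rwa [← hV, ← hV] at this
    exact ⟨D₀, E₀, f₁, hr, areParallelSides_of_fire hS (hVS false false) (hVS true false)
      (hVS false true) (hVS true true) f₁ h f₂ hF⟩
  · obtain ⟨D₀, m', -, -, hD₀, -⟩ := FarleyVertex.exists_fire (c := d)
      (x := x) (y := z ++ c.1 ++ y') hm hd (by rw [hD']; simp)
    let V : Bool → Bool → P.FarleyVertex w := fun i j => cond i (cond j E D) (cond j E₀ D₀)
    have hV : ∀ i j, (V i j).state = squarePath x z y' d c i j := by
      intro i j
      cases i <;> cases j
      · exact hD₀.trans (by simp [squarePath])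
      · exact hE₀.trans (by simp [squarePath])
      · exact hD'
      · exact hE'
    obtain ⟨S, hS, hVS⟩ := isCube_of_squarePath hF.1 hc hV
    have f₁ : P.Fire c D₀.state E₀.state := by
      have := fire_squarePath_right (x := x) (z := z) (y := y') (c₁ := d) hc false
      rwa [← hV, ← hV] at this
    have f₂ : P.Fire d D₀.state D.state := by
      have := fire_squarePath_left (x := x) (z := z) (y := y') (c₂ := c) hF.1 false
      rwa [← hV, ← hV] at this
    exact ⟨D₀, E₀, f₁, hr, areParallelSides_of_fire hS (hVS false false) (hVS false true)
      (hVS true false) (hVS true true) f₁ h f₂ hF⟩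

theorem exists_removable_ne {c : List (PathEdge α) × List α} {S : List (PathEdge α)}
    (hc : c ∈ cells S) (h : ¬ IsTip c S) : ∃ (d : List (PathEdge α) × List α) (x y : _),
      d.2 ≠ [] ∧ S = x ++ outs d.1 d.2 ++ y ∧ d ≠ c := by
  by_contra! h'
  exact h ⟨hc, h'⟩

/-- As long as `c` is not a tip, another removable cell is taken off both endpoints; the number of
cells decreases and the hyperplane stays the same. -/
theorem exists_isTip_dual_eq {c : List (PathEdge α) × List α} {n : ℕ} :
    ∀ {D E : P.FarleyVertex w} (h : P.Fire c D.state E.state), P.Reach w n E.state →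
      ∃ (D' E' : P.FarleyVertex w) (h' : P.Fire c D'.state E'.state), IsTip c E'.state ∧
        Hyperplane.dual ⟨s(D, E), fire_mem_edgeSet h⟩ =
          Hyperplane.dual ⟨s(D', E'), fire_mem_edgeSet h'⟩ := by
  induction n with
  | zero =>
    intro D E h hE
    have := h.cells_eq
    rw [show E.state = initPath w from hE, cells_initPath] at this
    exact absurd this.symm (Set.insert_nonempty _ _).ne_empty
  | succ n ih =>
    intro D E h hE
    by_cases ht : IsTip c E.state
    · exact ⟨D, E, h, ht, rfl⟩
    · obtain ⟨d, x, y, hd, hx, hdc⟩ := exists_removable_ne (by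
        rw [h.cells_eq]; exact Set.mem_insert _ _) ht
      obtain ⟨D₁, E₁, h₁, hr, hp⟩ := exists_parallel_of_fire h hE hd hdc hx
      obtain ⟨D', E', h', ht', heq⟩ := ih h₁ hr
      exact ⟨D', E', h', ht', (Quot.sound hp).symm.trans heq⟩

theorem fire_source_unique {c : List (PathEdge α) × List α} {D D' E : P.FarleyVertex w}
    (h : P.Fire c D.state E.state) (h' : P.Fire c D'.state E.state) : D = D' := by
  apply FarleyVertex.state_injective
  obtain ⟨n, hn⟩ := E.exists_reach
  obtain ⟨hc, x, y, hD, hE⟩ := h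
  obtain ⟨-, x', y', hD', hE'⟩ := h'
  have hnd := hn.nodup
  rw [hE] at hnd hE'
  obtain ⟨rfl, rfl⟩ := append_inj_of_nodup (outs_ne_nil hc.ne_nil.2) hnd hE'
  rw [hD, hD']

/-! ### Hyperplanes correspond to cells -/

namespace Hyperplane

/-- Both edges can be moved within their hyperplanes to an edge ending in the tip diagram of `c`.
That diagram is unique, and so is the vertex left after removing `c` from it. -/
theorem dual_eq_of_edgeCell {e f : (farleyGraph P w).edgeSet} {c : List (PathEdge α) × List α}
    (he : EdgeCell e.1 c) (hf : EdgeCell f.1 c) : dual e = dual f := by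
  obtain ⟨e, he'⟩ := e
  obtain ⟨f, hf'⟩ := f
  obtain ⟨D, E, rfl, h⟩ := he
  obtain ⟨D', E', rfl, h'⟩ := hf
  obtain ⟨n, hn⟩ := E.exists_reach
  obtain ⟨n', hn'⟩ := E'.exists_reach
  obtain ⟨D₁, E₁, h₁, ht, e₁⟩ := exists_isTip_dual_eq h hn
  obtain ⟨D₂, E₂, h₂, ht', e₂⟩ := exists_isTip_dual_eq h' hn'
  obtain ⟨m, hm⟩ := E₁.exists_reach
  obtain ⟨m', hm'⟩ := E₂.exists_reach
  obtain rfl := FarleyVertex.state_injective (ht.unique ht' hm hm')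
  obtain rfl := fire_source_unique h₁ h₂
  exact e₁.trans e₂.symm

theorem edgeCell_of_dual_eq {e f : (farleyGraph P w).edgeSet} {c : List (PathEdge α) × List α}
    (h : dual e = dual f) (he : EdgeCell e.1 c) : EdgeCell f.1 c := by
  have key : ∀ d, EdgeCell e.1 d ↔ EdgeCell f.1 d := by
    have h' := Quot.eqvGen_exact h
    clear h he
    induction h' with
    | refl => exact fun _ => Iff.rfl
    | symm _ _ _ ih => exact fun d => (ih d).symm
    | trans _ _ _ _ _ ih ih' => exact fun d => (ih d).trans (ih' d)
    | rel e f h =>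
      intro d
      obtain ⟨c₁, h₁⟩ := exists_edgeCell e.2
      obtain ⟨c₂, h₂⟩ := exists_edgeCell f.2
      obtain rfl := h.edgeCell_eq h₁ h₂
      exact ⟨fun h => h.unique h₁ ▸ h₂, fun h => h.unique h₂ ▸ h₁⟩
  exact (key c).1 he

theorem mem_edges_dual {e : (farleyGraph P w).edgeSet} {c : List (PathEdge α) × List α}
    (he : EdgeCell e.1 c) {f : Sym2 (P.FarleyVertex w)} :
    f ∈ (dual e).edges ↔ EdgeCell f c := by
  constructor
  · rintro ⟨hf, h⟩
    exact edgeCell_of_dual_eq h.symm he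
  · intro hf
    obtain ⟨D, E, rfl, h⟩ := id hf
    exact ⟨fire_mem_edgeSet h, dual_eq_of_edgeCell hf he⟩

end Hyperplane

/-! ### Halfspaces -/

section Halfspace

variable {c : List (PathEdge α) × List α} {Δ : P.FarleyVertex w} {J : Hyperplane P w}

theorem deleteEdges_adj_of_fire {d : List (PathEdge α) × List α} {D E : P.FarleyVertex w}
    (hJ : ∀ f, f ∈ J.edges ↔ EdgeCell f c) (h : P.Fire d D.state E.state) (hd : d ≠ c) :
    ((farleyGraph P w).deleteEdges J.edges).Adj D E := by
  rw [SimpleGraph.deleteEdges_adj, hJ]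
  exact ⟨FarleyVertex.adj_of_fire h, fun h' => hd (EdgeCell.unique ⟨D, E, rfl, h⟩ h')⟩

/-- Cells other than `c` are removed until `c` is a tip, which leaves `Δ` by uniqueness. Read
backwards, the removals give both the path and the complementary diagram. -/
theorem isPrefix_and_reachable_of_mem_cells (hJ : ∀ f, f ∈ J.edges ↔ EdgeCell f c)
    (hΔ : IsTip c Δ.state) {n : ℕ} : ∀ {D : P.FarleyVertex w}, P.Reach w n D.state →
      c ∈ cells D.state → Δ.diagram.IsPrefix D.diagram ∧
        ((farleyGraph P w).deleteEdges J.edges).Reachable Δ D := by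
  induction n with
  | zero =>
    intro D hD hc
    rw [show D.state = initPath w from hD, cells_initPath] at hc
    exact hc.elim
  | succ n ih =>
    intro D hD hc
    by_cases ht : IsTip c D.state
    · obtain ⟨m, hm⟩ := Δ.exists_reach
      obtain rfl := FarleyVertex.state_injective (hΔ.unique ht hm hD)
      exact ⟨⟨_, (Diagram.comp_trivial _).symm⟩, .refl _⟩
    · obtain ⟨d, x, y, hd, hx, hdc⟩ := exists_removable_ne hc ht
      obtain ⟨D₀, m, hnm, hr, -, hF⟩ := FarleyVertex.exists_fire hD hd hx
      obtain rfl : n = m := by omega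
      rw [hF.cells_eq] at hc
      obtain ⟨⟨Γ, hΓ⟩, h₂⟩ := ih hr (hc.resolve_left hdc.symm)
      obtain ⟨Γ', hΓ'⟩ := FarleyVertex.isPrefix_of_fire hF
      exact ⟨⟨Γ.comp Γ', by rw [hΓ', hΓ, Diagram.comp_assoc]⟩,
        h₂.trans (deleteEdges_adj_of_fire hJ hF hdc).reachable⟩

theorem reachable_base_of_notMem_cells (hJ : ∀ f, f ∈ J.edges ↔ EdgeCell f c) {n : ℕ} :
    ∀ {D : P.FarleyVertex w}, P.Reach w n D.state → c ∉ cells D.state →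
      ((farleyGraph P w).deleteEdges J.edges).Reachable (FarleyVertex.base P w) D := by
  induction n with
  | zero =>
    intro D hD hc
    obtain rfl : FarleyVertex.base P w = D := FarleyVertex.state_injective (Eq.symm hD)
    exact .refl _
  | succ n ih =>
    intro D hD hc
    obtain ⟨S, d, hS, hd, x, y, rfl, hx⟩ := id hD
    obtain ⟨D₀, m, hnm, hr, -, hF⟩ := FarleyVertex.exists_fire hD hd.ne_nil.2 hx
    obtain rfl : n = m := by omega
    rw [hF.cells_eq] at hc
    exact (ih hr fun h => hc (Or.inr h)).trans
      (deleteEdges_adj_of_fire hJ hF fun h => hc (Or.inl h.symm)).reachable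

/-- Only an edge that glues `c` can create or destroy `c`, and those edges have been deleted. -/
theorem mem_cells_of_reachable (hJ : ∀ f, f ∈ J.edges ↔ EdgeCell f c) {D E : P.FarleyVertex w}
    (h : ((farleyGraph P w).deleteEdges J.edges).Reachable D E) (hc : c ∈ cells D.state) :
    c ∈ cells E.state := by
  obtain ⟨p⟩ := h
  induction p with
  | nil => exact hc
  | @cons D E _ h _ ih =>
    refine ih ?_
    rw [SimpleGraph.deleteEdges_adj, hJ] at h
    obtain ⟨d, hF | hF⟩ := FarleyVertex.adj_iff.1 h.1
    · rw [hF.cells_eq]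
      exact Or.inr hc
    · rw [hF.cells_eq] at hc
      refine hc.resolve_left ?_
      rintro rfl
      exact h.2 ⟨E, D, Sym2.eq_swap, hF⟩

theorem mem_prefixCone_iff (hJ : ∀ f, f ∈ J.edges ↔ EdgeCell f c) (hΔ : IsTip c Δ.state)
    {D : P.FarleyVertex w} : D ∈ Δ.prefixCone ↔ c ∈ cells D.state := by
  constructor
  · exact fun h => FarleyVertex.cells_subset_of_isPrefix h hΔ.1
  · intro h
    obtain ⟨n, hn⟩ := D.exists_reach
    exact (isPrefix_and_reachable_of_mem_cells hJ hΔ hn h).1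

/-- Exactly two components remain: the vertices containing `c`, all connected to `Δ`, and those
without `c`, all connected to `ε(w)`. -/
theorem isPositiveHalfspace_prefixCone (hJ : ∀ f, f ∈ J.edges ↔ EdgeCell f c)
    (hΔ : IsTip c Δ.state) : J.IsPositiveHalfspace Δ.prefixCone := by
  have hup : ∀ {D : P.FarleyVertex w}, c ∈ cells D.state →
      ((farleyGraph P w).deleteEdges J.edges).Reachable Δ D := by
    intro D h
    obtain ⟨n, hn⟩ := D.exists_reach
    exact (isPrefix_and_reachable_of_mem_cells hJ hΔ hn h).2
  have hsupp : (((farleyGraph P w).deleteEdges J.edges).connectedComponentMk Δ).supp =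
      Δ.prefixCone := by
    ext D
    rw [SimpleGraph.ConnectedComponent.mem_supp_iff, SimpleGraph.ConnectedComponent.eq,
      mem_prefixCone_iff hJ hΔ]
    exact ⟨fun h => mem_cells_of_reachable hJ h.symm hΔ.1, fun h => (hup h).symm⟩
  intro T
  constructor
  · rintro ⟨⟨K, rfl⟩, hb⟩
    induction K using SimpleGraph.ConnectedComponent.ind with | _ D =>
    by_cases hc : c ∈ cells D.state
    · rw [← hsupp, SimpleGraph.ConnectedComponent.eq.2 (hup hc)]
    · obtain ⟨n, hn⟩ := D.exists_reach
      exact absurd (SimpleGraph.ConnectedComponent.eq.2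
        (reachable_base_of_notMem_cells hJ hn hc)) hb
  · rintro rfl
    refine ⟨⟨_, hsupp.symm⟩, ?_⟩
    rw [mem_prefixCone_iff hJ hΔ, show (FarleyVertex.base P w).state = initPath w from rfl,
      cells_initPath]
    exact id

end Halfspace

/-! ### The bijection -/

/-- Mutual prefixes have the same set of cells, which determines the diagram. -/
theorem FarleyVertex.eq_of_prefixCone_eq {D E : P.FarleyVertex w}
    (h : D.prefixCone = E.prefixCone) : D = E := by
  have h₁ : E ∈ D.prefixCone := h ▸ ⟨_, (Diagram.comp_trivial _).symm⟩
  have h₂ : D ∈ E.prefixCone := h ▸ ⟨_, (Diagram.comp_trivial _).symm⟩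
  obtain ⟨n, hn⟩ := D.exists_reach
  obtain ⟨m, hm⟩ := E.exists_reach
  exact state_injective (hn.eq_of_cells_eq hm (subset_antisymm
    (cells_subset_of_isPrefix h₁) (cells_subset_of_isPrefix h₂)))

namespace Hyperplane

theorem IsPositiveHalfspace.unique {J : Hyperplane P w} {S T : Set (P.FarleyVertex w)}
    (hS : J.IsPositiveHalfspace S) (hT : J.IsPositiveHalfspace T) : S = T :=
  (hT S).1 ((hS S).2 rfl)

theorem exists_isTip (J : Hyperplane P w) : ∃ c, (∀ f, f ∈ J.edges ↔ EdgeCell f c) ∧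
    ∃ Δ : P.FarleyVertex w, IsTip c Δ.state := by
  induction J using Quot.ind with | mk e =>
  obtain ⟨c, hc⟩ := exists_edgeCell e.2
  refine ⟨c, fun f => mem_edges_dual hc, ?_⟩
  obtain ⟨D, E, -, h⟩ := hc
  obtain ⟨n, hn⟩ := E.exists_reach
  obtain ⟨-, Δ, -, hΔ, -⟩ := exists_isTip_dual_eq h hn
  exact ⟨Δ, hΔ⟩

theorem existsUnique_isMinimal (J : Hyperplane P w) : ∃! Δ : P.FarleyVertex w,
    Δ.diagram.IsMinimal ∧ J.IsPositiveHalfspace Δ.prefixCone := by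
  obtain ⟨c, hJ, Δ, hΔ⟩ := J.exists_isTip
  refine ⟨Δ, ⟨FarleyVertex.isMinimal_of_isTip hΔ, isPositiveHalfspace_prefixCone hJ hΔ⟩, ?_⟩
  rintro E ⟨-, hE⟩
  exact FarleyVertex.eq_of_prefixCone_eq (hE.unique (isPositiveHalfspace_prefixCone hJ hΔ))

/-- The common halfspace yields a common tip diagram, hence a common tip. The edge that removes this
tip belongs to both hyperplanes. -/
theorem eq_of_isPositiveHalfspace {J K : Hyperplane P w} {S : Set (P.FarleyVertex w)}
    (hJ : J.IsPositiveHalfspace S) (hK : K.IsPositiveHalfspace S) : J = K := by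
  obtain ⟨c, hc, Δ, hΔ⟩ := J.exists_isTip
  obtain ⟨d, hd, Δ', hΔ'⟩ := K.exists_isTip
  have h₁ := hJ.unique (isPositiveHalfspace_prefixCone hc hΔ)
  have h₂ := hK.unique (isPositiveHalfspace_prefixCone hd hΔ')
  obtain rfl := FarleyVertex.eq_of_prefixCone_eq (h₁.symm.trans h₂)
  obtain ⟨n, hn⟩ := Δ.exists_reach
  obtain ⟨hne, x, y, hx⟩ := hΔ.exists_eq hn
  obtain rfl := hΔ'.2 c x y hne hx
  obtain ⟨D, m, -, -, -, hF⟩ := FarleyVertex.exists_fire hn hne hx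
  obtain ⟨_, h₃⟩ := (hc s(D, Δ)).2 ⟨D, Δ, rfl, hF⟩
  obtain ⟨_, h₄⟩ := (hd s(D, Δ)).2 ⟨D, Δ, rfl, hF⟩
  exact h₃.symm.trans h₄

end Hyperplane

theorem FarleyVertex.isPositiveHalfspace_of_isMaximalThinSuffix {Δ : P.FarleyVertex w}
    (hΔ : Δ.diagram.IsMinimal) {v : List α} {F : P.Diagram v Δ.bot}
    (hF : F.IsMaximalThinSuffix Δ.diagram) {E : P.FarleyVertex w} (hE : Δ.IsProduct F.inv E) :
    ∃ h : s(Δ, E) ∈ (P.farleyGraph w).edgeSet,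
      (Hyperplane.dual ⟨s(Δ, E), h⟩).IsPositiveHalfspace Δ.prefixCone := by
  -- Minimality provides some maximal thin suffix with one cell; two maximal thin suffixes are
  -- suffixes of each other, so `F` has one cell too.
  have h1 : F.numCells = 1 := by
    obtain ⟨v', F', hF', h1⟩ := hΔ
    obtain ⟨A, hA⟩ := hF.2.2 v' F' hF'.1 hF'.2.1
    obtain ⟨B, hB⟩ := hF'.2.2 v F hF.1 hF.2.1
    have hA' := congrArg Diagram.numCells hA
    have hB' := congrArg Diagram.numCells hB
    rw [Diagram.numCells_comp] at hA' hB'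
    omega
  obtain ⟨c, hc, hfire⟩ := exists_isTip hF h1
  have h := hfire E hE
  exact ⟨(adj_of_fire h).symm, isPositiveHalfspace_prefixCone
    (fun f => Hyperplane.mem_edges_dual ⟨E, Δ, Sym2.eq_swap, h⟩) hc⟩

end SemigroupPresentation

theorem proposition2p2 {α : Type*} (P : SemigroupPresentation α) (w : List α) (hw : w ≠ []) :
    -- every hyperplane `J` has a unique minimal diagram `Δ` with `J⁺ = {D | Δ ≤ D}`
    (∀ J : P.Hyperplane w, ∃! Δ : P.FarleyVertex w,
      Δ.diagram.IsMinimal ∧ J.IsPositiveHalfspace Δ.prefixCone) ∧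
    -- conversely, if `Δ` is minimal with maximal thin suffix `F`, then `E = Δ · F⁻¹` is adjacent to
    -- `Δ`, and the hyperplane `J` dual to the edge `[Δ, E]` satisfies `J⁺ = {D | Δ ≤ D}`
    (∀ Δ : P.FarleyVertex w, Δ.diagram.IsMinimal →
      ∀ (v : List α) (F : P.Diagram v Δ.bot), F.IsMaximalThinSuffix Δ.diagram →
        (∃ E : P.FarleyVertex w, Δ.IsProduct F.inv E) ∧
        ∀ E : P.FarleyVertex w, Δ.IsProduct F.inv E →
          ∃ h : s(Δ, E) ∈ (P.farleyGraph w).edgeSet,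
            (SemigroupPresentation.Hyperplane.dual ⟨s(Δ, E), h⟩).IsPositiveHalfspace Δ.prefixCone) ∧
    -- hence hyperplanes and minimal diagrams are in bijection
    (∃ Φ : P.Hyperplane w ≃ {Δ : P.FarleyVertex w // Δ.diagram.IsMinimal},
      ∀ J : P.Hyperplane w, J.IsPositiveHalfspace (Φ J).1.prefixCone) := by
  refine ⟨fun J => J.existsUnique_isMinimal, fun Δ hΔ v F hF =>
    ⟨Δ.exists_isProduct F.inv, fun E hE =>
      SemigroupPresentation.FarleyVertex.isPositiveHalfspace_of_isMaximalThinSuffix hΔ hF hE⟩, ?_⟩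
  choose φ hφ _ using fun J : P.Hyperplane w => J.existsUnique_isMinimal
  refine ⟨Equiv.ofBijective (fun J => ⟨φ J, (hφ J).1⟩) ⟨?_, ?_⟩, fun J => (hφ J).2⟩
  · intro J K h
    refine SemigroupPresentation.Hyperplane.eq_of_isPositiveHalfspace (hφ J).2 ?_
    rw [show φ J = φ K from congrArg Subtype.val h]
    exact (hφ K).2
  -- The preimage is the hyperplane dual to the edge that removes the tip of `Δ`; its chosen diagram
  -- and `Δ` have the same cone.
  · rintro ⟨Δ, hΔ⟩
    obtain ⟨v, F, hF, -⟩ := id hΔ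
    obtain ⟨E, hE⟩ := Δ.exists_isProduct F.inv
    obtain ⟨h, hJ⟩ :=
      SemigroupPresentation.FarleyVertex.isPositiveHalfspace_of_isMaximalThinSuffix hΔ hF hE
    exact ⟨_, Subtype.ext (SemigroupPresentation.FarleyVertex.eq_of_prefixCone_eq
      ((hφ _).2.unique hJ))⟩
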